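/- Let $\ell$ be a prime number and let $F$ be a global function field of characteristic $\ell$, i.e. a finite extension of $\mathbb{F}_\ell(T)$. Let $\kappa$ be its field of constants, i.e. the algebraic closure of $\mathbb{F}_\ell$ in $F$. A prime $v$ of $F$ is given by a discrete valuation ring $\mathcal{O}_v\subset F$ with fraction field $F$, and its degree is the dimension over $\kappa$ of its residue field. Assume that $F$ has a prime $P_\infty$ of degree $1$, and let $\mathcal{O}_F$ be the ring of all functions in $F$ with no poles away from $P_\infty$. For $N\ge 1$ let $h_F[N]$ denote the number of elements of the $N$-torsion of the class group of $F$ (divisors of degree $0$ modulo principal divisors). Let $q\neq \ell$ be a prime number and let $k>0$ be the least positive integer such that $h_F[q^k]=h_F[q^{k-1}]$. Let $f\in\kappa[X]$ satisfy the following conditions. 1. $f(X)=a_0(X-a_1)^{n_1}\cdots(X-a_t)^{n_t}$, where $a_0\in\kappa$ is nonzero, $a_1,\dots,a_t$ are distinct elements of $\kappa$, $n_1,\dots,n_t$ are positive integers, and $t\ge 2$. 2. At least two of the exponents $n_i$ are not divisible by $q$. Then every solution $(X,Y)\in\mathcal{O}_F^2$ of $$Y^{q^k}=f(X)$$ is constant,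 i.e. $X$ and $Y$ both lie in $\kappa$. -/

import Mathlib

noncomputable section

namespace GlobalFF

/-- The field of constants `κ` of a field `F` of characteristic `ℓ`: the algebraic closure of the
prime field `𝔽_ℓ` in `F`. -/
abbrev constants (ℓ : ℕ) [Fact ℓ.Prime] (F : Type*) [Field F] [Algebra (ZMod ℓ) F] :
    IntermediateField (ZMod ℓ) F :=
  algebraicClosure (ZMod ℓ) F

/-- A prime of `F`, given by its discrete valuation ring `𝒪_v ⊂ F` with fraction field `F`.
(A subring of `F` which is a discrete valuation ring with fraction field `F` is the same thing as a
valuation subring of `F` which is a discrete valuation ring.) -/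
structure Prime (F : Type*) [Field F] where
  /-- The local ring `𝒪_v`. -/
  ring : ValuationSubring F
  isDVR : IsDiscreteValuationRing ring

attribute [instance] Prime.isDVR

section Order

variable {F : Type*} [Field F]

/-- The order of vanishing `ord_v(g)` of `g ≠ 0` at the prime `v`
(with the dummy value `ord_v(0) = 0`). -/
def ord (v : Prime F) (g : F) : ℤ :=
  -WithZero.log ((IsDiscreteValuationRing.maximalIdeal v.ring).valuation F g)

theorem ord_one (v : Prime F) : ord v 1 = 0 := by
  simp [ord]

theorem ord_mul (v : Prime F) {g h : F} (hg : g ≠ 0) (hh : h ≠ 0) :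
    ord v (g * h) = ord v g + ord v h := by
  unfold ord
  rw [map_mul, WithZero.log_mul (by simpa using hg) (by simpa using hh)]
  ring

theorem ord_inv (v : Prime F) (g : F) : ord v g⁻¹ = -ord v g := by
  unfold ord
  rw [map_inv₀, WithZero.log_inv]

/-- The ring of integers `𝒪_F` attached to the prime `P`: the functions with no poles away
from `P`. -/
def integers (P : Prime F) : Subring F where
  carrier := {g | ∀ v : Prime F, v ≠ P → g ∈ v.ring}
  mul_mem' hx hy v hv := mul_mem (hx v hv) (hy v hv)
  one_mem' v _ := one_mem v.ring
  add_mem' hx hy v hv := add_mem (hx v hv) (hy v hv)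
  zero_mem' v _ := zero_mem v.ring
  neg_mem' hx v hv := neg_mem (hx v hv)

end Order

/-- The group of divisors of `F`: finite formal sums `∑ n_v v` of primes. -/
abbrev Divisor (F : Type*) [Field F] := Prime F →₀ ℤ

/-- The subgroup of principal divisors `div(g) = ∑ ord_v(g) v`, `g` a nonzero element of `F`. -/
def principal (F : Type*) [Field F] : AddSubgroup (Divisor F) where
  carrier := {D | ∃ g : F, g ≠ 0 ∧ ∀ v : Prime F, D v = ord v g}
  zero_mem' := ⟨1, one_ne_zero, fun v => by simp [ord_one]⟩
  add_mem' := by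
    rintro D E ⟨g, hg, hD⟩ ⟨h, hh, hE⟩
    exact ⟨g * h, mul_ne_zero hg hh, fun v => by simp [hD, hE, ord_mul v hg hh]⟩
  neg_mem' := by
    rintro D ⟨g, hg, hD⟩
    exact ⟨g⁻¹, inv_ne_zero hg, fun v => by simp [hD, ord_inv]⟩

section Degree

variable (ℓ : ℕ) [Fact ℓ.Prime] {F : Type*} [Field F] [Algebra (ZMod ℓ) F]

/-- Constants are regular at every prime. -/
theorem constants_mem (v : Prime F) (c : constants ℓ F) : (c : F) ∈ v.ring := by
  have hc : IsIntegral (ZMod ℓ) (c : F) := c.2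
  have hm : ∀ a : ZMod ℓ, algebraMap (ZMod ℓ) F a ∈ v.ring := fun a => by
    obtain ⟨n, rfl⟩ := ZMod.natCast_zmod_surjective a
    rw [map_natCast]
    exact natCast_mem v.ring n
  obtain ⟨p, hp, h0⟩ := hc
  let φ : ZMod ℓ →+* v.ring := (algebraMap (ZMod ℓ) F).codRestrict v.ring.toSubring hm
  have hi : IsIntegral v.ring (c : F) := by
    refine ⟨p.map φ, hp.map φ, ?_⟩
    rw [Polynomial.eval₂_map]
    exact h0
  obtain ⟨y, hy⟩ := IsIntegrallyClosed.isIntegral_iff.mp hi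
  rw [← hy]
  exact y.2

/-- The inclusion `κ ⊂ 𝒪_v`; through it the residue field of `v` is a `κ`-algebra. -/
instance constantsAlgebra (v : Prime F) : Algebra (constants ℓ F) v.ring :=
  ((algebraMap (constants ℓ F) F).codRestrict v.ring.toSubring
    (fun c => constants_mem ℓ v c)).toAlgebra

/-- The degree of a prime: the dimension over `κ` of its residue field. -/
def primeDegree (v : Prime F) : ℕ :=
  Module.finrank (constants ℓ F) (IsLocalRing.ResidueField v.ring)

variable (F)

/-- The degree `∑ n_v deg v` of a divisor `∑ n_v v`. -/
def degree : Divisor F →+ ℤ :=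
  Finsupp.liftAddHom fun v => AddMonoidHom.mulRight (primeDegree ℓ v : ℤ)

/-- The class group of `F`: divisors of degree `0` modulo principal divisors. -/
abbrev ClassGroup : Type _ :=
  (degree ℓ F).ker ⧸ (principal F).addSubgroupOf (degree ℓ F).ker

/-- `h_F[N]`: the number of elements of the `N`-torsion of the class group of `F`. -/
def torsionCard (N : ℕ) : ℕ :=
  Nat.card {c : ClassGroup ℓ F // N • c = 0}

end Degree

end GlobalFF

end

/-! Suppose `X` is nonconstant. Away from `P` every `X - a i` is regular, and no two of them vanish
at the same prime, since they differ by a nonzero constant. If `q ∤ n i`, comparing orders in the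
equation gives `q ^ k ∣ ord v (X - a i)` for `v ≠ P`; principal divisors have degree `0` and `P` has
degree `1`, so this holds at `P` too. Thus `X - a i` has divisor `q ^ k • D`. The class of `D` is
killed by `q ^ k`, hence by `q ^ (k - 1)`, because the class group is finite and the two torsion
counts agree. Writing `q ^ (k - 1) • D` as the divisor of `z` makes `X - a i` a constant times `z ^
q` (`exists_eq_constant_mul_pow`).

Two such indices give `u z ^ q - w y ^ q = c` with nonzero constants `u`, `w`, `c`, and
`mem_constants_of_fermat` shows that `y` is constant. Otherwise `y` has a pole at `P`, so `(z / y) ^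
q` reduces to `w / u` there; the residue field is `κ`, so `w / u = β ^ q` with `β ∈ κ`. Then `z - β
y` divides a nonzero constant in `𝒪_F`, hence is a constant `d`, and `(d + β y) ^ q - (β y) ^ q` is
constant although its linear coefficient `q d ^ (q - 1) β` is nonzero (here `q ≠ ℓ` enters). This
contradicts the transcendence of `y`.

The two global inputs, `degree_divisor` and the finiteness of the class group, come from counting
the spaces `L(D)` over the finite field `κ`: leading coefficients bound their growth from above, and
polynomial combinations of a basis of `F` over `κ(x)` bound it from below. -/

noncomputable section

open Polynomial IntermediateField WithZero

/-! ### Linear independence and finiteness over `K(x)` -/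

section FieldTheory

variable {K F : Type*} [Field K] [Field F] [Algebra K F]

open scoped algebraAdjoinAdjoin in
/-- A family is linearly independent over `K(x)` as soon as the constant coefficients vanish in
every relation with coefficients in `K[x]`. -/
theorem linearIndependent_adjoin_simple {x : F} (hx : x ≠ 0) {ι : Type*} (u : ι → F)
    (h : ∀ (s : Finset ι) (p : ι → K[X]), ∑ i ∈ s, aeval x (p i) * u i = 0 →
      ∀ i ∈ s, (p i).coeff 0 = 0) : LinearIndependent K⟮x⟯ u := by
  -- Once the constant coefficients vanish, the relation can be divided by `x`, which shifts every
  -- coefficient down by one.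
  have key : ∀ (n : ℕ) (s : Finset ι) (p : ι → K[X]), ∑ i ∈ s, aeval x (p i) * u i = 0 →
      ∀ i ∈ s, (p i).coeff n = 0 := by
    intro n
    induction n with
    | zero => exact h
    | succ n ih =>
      intro s p hp i hi
      rw [← coeff_divX]
      refine ih s (fun i => (p i).divX) ?_ i hi
      refine (mul_eq_zero.mp ?_).resolve_left hx
      rw [← hp, Finset.mul_sum]
      refine Finset.sum_congr rfl fun j hj => ?_
      conv_rhs => rw [← X_mul_divX_add (p j), h s p hp j hj]
      simp [mul_assoc]
  rw [← LinearIndependent.iff_fractionRing (Algebra.adjoin K {x}), linearIndependent_iff']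
  intro s g hg i hi
  have hg' : ∀ i, ∃ p : K[X], aeval x p = (g i : F) := fun i =>
    (Algebra.adjoin_singleton_eq_range_aeval K x).le (g i).2
  choose p hp using hg'
  have h0 : p i = 0 := by
    ext n
    refine key n s p ?_ i hi
    rw [← hg]
    exact Finset.sum_congr rfl fun j _ => by rw [hp, Algebra.smul_def]; rfl
  exact Subtype.ext (by rw [← hp, h0, map_zero]; rfl)

/-- If `F` is a finitely generated field extension of transcendence degree at most one of `K`, it is
finite over `K(x)` for every transcendental `x`. -/
theorem finiteDimensional_adjoin_simple [Algebra.EssFiniteType K F] (htr : Algebra.trdeg K F ≤ 1)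
    {x : F} (hx : Transcendental K x) : FiniteDimensional K⟮x⟯ F := by
  have hi : AlgebraicIndependent K fun _ : Unit => x :=
    algebraicIndependent_unique_type_iff.mpr hx
  have hb := hi.isTranscendenceBasis_of_lift_trdeg_le_of_finite (by simpa using htr)
  have h1 := hb.isAlgebraic_field
  rw [Set.range_const] at h1
  have h2 : Algebra.EssFiniteType K⟮x⟯ F := .of_comp K _ _
  have h3 : IntermediateField.FG (⊤ : IntermediateField K⟮x⟯ F) := fg_top _ _
  obtain ⟨s, hs⟩ := h3
  have h4 := finiteDimensional_adjoin (K := K⟮x⟯) (S := (s : Set F))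
    fun y _ => (Algebra.IsAlgebraic.isAlgebraic y).isIntegral
  rw [hs] at h4
  exact Module.Finite.equiv (topEquiv (F := K⟮x⟯) (E := F)).toLinearEquiv

/-- A subextension of `F / K` over which some `x` stays transcendental has degree at most
`[F : K(x)]`. -/
theorem finiteDimensional_of_transcendental (L : IntermediateField K F) {x : F}
    (hx : Transcendental L x) [FiniteDimensional K⟮x⟯ F] : FiniteDimensional K L := by
  have h0 : x ≠ 0 := fun h => hx (h ▸ isAlgebraic_zero)
  refine Module.rank_lt_aleph0_iff.mp
    ((rank_le (n := Module.finrank K⟮x⟯ F) fun s hs => ?_).trans_lt Cardinal.natCast_lt_aleph0)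
  -- A relation over `K[x]` is a polynomial over `L` vanishing at `x`, hence zero; its constant
  -- coefficient is a `K`-relation.
  have : LinearIndependent K⟮x⟯ fun i : s => ((i : L) : F) := by
    refine linearIndependent_adjoin_simple h0 _ fun t p hp => ?_
    have h1 : ∑ i ∈ t, (p i).map (algebraMap K L) * C (i : L) = 0 := by
      by_contra hne
      refine hx ⟨_, hne, ?_⟩
      rw [← hp, map_sum]
      refine Finset.sum_congr rfl fun i _ => ?_
      rw [map_mul, aeval_map_algebraMap, aeval_C]
      rfl
    refine linearIndependent_iff'.mp hs t (fun i => (p i).coeff 0) ?_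
    have h2 := congrArg (fun r => coeff r 0) h1
    simpa [finsetSum_coeff, Algebra.smul_def] using h2
  simpa using this.fintype_card_le_finrank

/-- A module over `K[x]` inside `F` has a quotient by `x` of dimension at most `[F : K(x)]`. -/
theorem finrank_quotient_le_finrank_adjoin {x : F} (hx : x ≠ 0) [FiniteDimensional K⟮x⟯ F]
    (R N : Submodule K F) (hN : ∀ r ∈ R, x * r ∈ N) (hNR : N ≤ R) :
    Module.Finite K (R ⧸ N.submoduleOf R) ∧
      Module.finrank K (R ⧸ N.submoduleOf R) ≤ Module.finrank K⟮x⟯ F := by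
  have hR : ∀ (p : K[X]), ∀ r ∈ R, aeval x p * r ∈ R := by
    intro p r hr
    induction p using Polynomial.induction_on' with
    | add p q hp hq => rw [map_add, add_mul]; exact R.add_mem hp hq
    | monomial n a =>
      rw [aeval_monomial, mul_assoc, ← Algebra.smul_def]
      refine R.smul_mem a ?_
      induction n with
      | zero => simpa
      | succ n ih => rw [pow_succ', mul_assoc]; exact hNR (hN _ ih)
  have hrank : Module.rank K (R ⧸ N.submoduleOf R) ≤ (Module.finrank K⟮x⟯ F : ℕ) := by
    refine rank_le fun s hs => ?_
    choose lift hlift using Submodule.Quotient.mk_surjective (N.submoduleOf R)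
    -- Modulo `x R ⊆ N`, a relation among the lifts retains only its constant coefficients.
    have : LinearIndependent K⟮x⟯ fun i : s => ((lift i : R) : F) := by
      refine linearIndependent_adjoin_simple hx _ fun t p hp => ?_
      refine linearIndependent_iff'.mp hs t (fun i => (p i).coeff 0) ?_
      have h1 : ∑ i ∈ t, (p i).coeff 0 • ((lift i : R) : F) =
          x * -∑ i ∈ t, aeval x (p i).divX * ((lift i : R) : F) := by
        rw [mul_neg, eq_neg_iff_add_eq_zero, ← hp, Finset.mul_sum, ← Finset.sum_add_distrib]
        refine Finset.sum_congr rfl fun i _ => ?_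
        conv_rhs => rw [← X_mul_divX_add (p i)]
        simp only [map_add, map_mul, aeval_X, aeval_C, Algebra.smul_def]
        ring
      have h2 : ∑ i ∈ t, (p i).coeff 0 • lift i ∈ N.submoduleOf R := by
        change ((∑ i ∈ t, (p i).coeff 0 • lift i : R) : F) ∈ N
        push_cast
        rw [h1]
        exact hN _ (R.neg_mem (R.sum_mem fun i _ => hR _ _ (lift i).2))
      rw [← Submodule.Quotient.mk_eq_zero] at h2
      rw [← h2, ← Submodule.mkQ_apply, map_sum]
      refine Finset.sum_congr rfl fun i _ => ?_
      rw [map_smul, Submodule.mkQ_apply, hlift]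
    simpa using this.fintype_card_le_finrank
  have : Module.Finite K (R ⧸ N.submoduleOf R) :=
    Module.rank_lt_aleph0_iff.mp (hrank.trans_lt Cardinal.natCast_lt_aleph0)
  exact ⟨this, Module.finrank_le_of_rank_le hrank⟩

/-- A chain of elements of increasing value starting at `x` is linearly independent over `K(x)`. -/
theorem linearIndependent_of_strictMono_valuation {Γ : Type*} [LinearOrderedCommGroupWithZero Γ]
    (v : Valuation F Γ) (hK : ∀ c : K, c ≠ 0 → v (algebraMap K F c) = 1) (f : ℕ → F)
    (h0 : f 0 ≠ 0) (h1 : ∀ i, v (f i) < 1) (hf : StrictMono fun i => v (f i)) :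
    LinearIndependent K⟮f 0⟯ f := by
  set x := f 0 with hxdef
  have hle : ∀ p : K[X], v (aeval x p) ≤ 1 := by
    intro p
    rw [aeval_eq_sum_range]
    refine v.map_sum_le fun i _ => ?_
    rw [Algebra.smul_def, map_mul, map_pow]
    refine mul_le_one' ?_ (pow_le_one' (h1 0).le _)
    by_cases hc : p.coeff i = 0
    · simp [hc]
    · exact (hK _ hc).le
  have hlt : ∀ p : K[X], p.coeff 0 = 0 → v (aeval x p) ≤ v x := by
    intro p hp
    rw [← X_mul_divX_add p, hp]
    simpa using mul_le_of_le_one_right' (hle p.divX)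
  have heq : ∀ p : K[X], p.coeff 0 ≠ 0 → v (aeval x p) = 1 := by
    intro p hp
    conv_lhs => rw [← X_mul_divX_add p]
    rw [map_add, aeval_C, v.map_add_eq_of_lt_right, hK _ hp]
    rw [hK _ hp, map_mul, aeval_X, map_mul]
    exact (mul_le_of_le_one_right' (hle p.divX)).trans_lt (h1 0)
  refine linearIndependent_adjoin_simple h0 _ fun s p hp => ?_
  by_contra! hcon
  classical
  have hne : (s.filter fun i => (p i).coeff 0 ≠ 0).Nonempty := by
    obtain ⟨i, hi, hi'⟩ := hcon
    exact ⟨i, Finset.mem_filter.mpr ⟨hi, hi'⟩⟩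
  -- The `j`-th term strictly dominates: smaller indices have smaller `v (f i)`, and for larger ones
  -- `x ∣ p i` makes the value less than `v x ≤ v (f j)`.
  set j := (s.filter fun i => (p i).coeff 0 ≠ 0).max' hne with hj
  obtain ⟨hjs, hj0⟩ := Finset.mem_filter.mp (Finset.max'_mem _ hne)
  rw [← hj] at hjs hj0
  have hfj : v (f j) ≠ 0 := by
    have : v x ≤ v (f j) := hf.monotone (Nat.zero_le j)
    have hx : v x ≠ 0 := v.ne_zero_iff.mpr h0
    exact (lt_of_lt_of_le (zero_lt_iff.mpr hx) this).ne'
  have h2 : v (∑ i ∈ s, aeval x (p i) * f i) = v (aeval x (p j) * f j) := by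
    refine v.map_sum_eq_of_lt hjs fun i hi => ?_
    obtain ⟨hi, hij⟩ := Finset.mem_sdiff.mp hi
    rw [Finset.mem_singleton] at hij
    rw [map_mul, map_mul, heq _ hj0, one_mul]
    rcases lt_or_gt_of_ne hij with h | h
    · exact (mul_le_of_le_one_left' (hle _)).trans_lt (hf h)
    · have hi0 : (p i).coeff 0 = 0 := by
        by_contra hc
        exact absurd (Finset.le_max' _ i (Finset.mem_filter.mpr ⟨hi, hc⟩)) (not_le.mpr h)
      calc v (aeval x (p i)) * v (f i) ≤ v x * v (f i) := by gcongr; exact hlt _ hi0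
        _ < v x * 1 := by
            have hx : 0 < v x := zero_lt_iff.mpr (v.ne_zero_iff.mpr h0)
            exact mul_lt_mul_of_pos_left (h1 i) hx
        _ ≤ v (f j) := by rw [mul_one]; exact hf.monotone (Nat.zero_le j)
  rw [hp, map_zero, map_mul, heq _ hj0, one_mul] at h2
  exact hfj h2.symm

end FieldTheory

/-! ### Constants of a global function field -/

namespace GlobalFF

/-- `F` is a global function field, in terms of its field of constants `κ`: the field `κ` is finite,
some element of `F` lies outside `κ`, and `F` is finite over `κ(x)` for every such `x`. -/
class IsGlobal (ℓ : ℕ) [Fact ℓ.Prime] (F : Type*) [Field F] [Algebra (ZMod ℓ) F] : Prop where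
  finite_constants : Finite (constants ℓ F)
  exists_notMem : ∃ x : F, x ∉ constants ℓ F
  finite_adjoin : ∀ x : F, x ∉ constants ℓ F → FiniteDimensional (constants ℓ F)⟮x⟯ F

section Constants

variable {ℓ : ℕ} [Fact ℓ.Prime] {F : Type*} [Field F] [Algebra (ZMod ℓ) F]

theorem mem_constants_of_isAlgebraic {x : F} (hx : IsAlgebraic (constants ℓ F) x) :
    x ∈ constants ℓ F := by
  rw [mem_algebraicClosure_iff]
  exact hx.restrictScalars (ZMod ℓ)

theorem transcendental_of_notMem {x : F} (hx : x ∉ constants ℓ F) :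
    Transcendental (constants ℓ F) x :=
  fun h => hx (mem_constants_of_isAlgebraic h)

/-- `F` is finitely generated of transcendence degree one over `𝔽_ℓ`, so it is finite over `𝔽_ℓ(x)`
for transcendental `x`. As `x` stays transcendental over `κ`, the degree of `κ` over `𝔽_ℓ` is
bounded by that of `F` over `𝔽_ℓ(x)`. -/
theorem isGlobal_of_functionField (ℓ : ℕ) [Fact ℓ.Prime] (F : Type*) [Field F] [Algebra (ZMod ℓ) F]
    [Algebra (RatFunc (ZMod ℓ)) F] [IsScalarTower (ZMod ℓ) (RatFunc (ZMod ℓ)) F]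
    [FunctionField (ZMod ℓ) F] : IsGlobal ℓ F := by
  have h1 : Algebra.EssFiniteType (ZMod ℓ) (RatFunc (ZMod ℓ)) := by
    have := Algebra.EssFiniteType.of_isLocalization (RatFunc (ZMod ℓ)) (nonZeroDivisors (ZMod ℓ)[X])
    exact .comp (ZMod ℓ) (ZMod ℓ)[X] _
  have h2 : Algebra.EssFiniteType (ZMod ℓ) F := .comp (ZMod ℓ) (RatFunc (ZMod ℓ)) F
  have htr : Algebra.trdeg (ZMod ℓ) F = 1 := by
    have := IsLocalization.isAlgebraic (RatFunc (ZMod ℓ)) (nonZeroDivisors (ZMod ℓ)[X])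
    have hR : Algebra.trdeg (ZMod ℓ) (RatFunc (ZMod ℓ)) = 1 := by
      rw [← trdeg_add_eq (ZMod ℓ) (ZMod ℓ)[X] (A := RatFunc (ZMod ℓ)),
        Polynomial.trdeg_of_isDomain, trdeg_eq_zero, add_zero]
    have := lift_trdeg_add_eq (ZMod ℓ) (RatFunc (ZMod ℓ)) F
    rw [hR, trdeg_eq_zero] at this
    simpa using this.symm
  have htr' : Algebra.trdeg (constants ℓ F) F = 1 := by
    have := trdeg_add_eq (ZMod ℓ) (constants ℓ F) (A := F)
    rwa [htr, trdeg_eq_zero, zero_add] at this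
  have h3 : ∃ x : F, x ∉ constants ℓ F := by
    by_contra! hcon
    have : Algebra.IsAlgebraic (ZMod ℓ) F := ⟨fun x => mem_algebraicClosure_iff.mp (hcon x)⟩
    rw [trdeg_eq_zero] at htr
    exact zero_ne_one htr
  refine ⟨?_, h3, fun x hx => ?_⟩
  · obtain ⟨x, hx⟩ := h3
    have := finiteDimensional_adjoin_simple htr.le (x := x)
      fun h => hx (mem_algebraicClosure_iff.mpr h)
    have := finiteDimensional_of_transcendental (constants ℓ F) (transcendental_of_notMem hx)
    exact Module.finite_of_finite (ZMod ℓ)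
  · have : Algebra.EssFiniteType (constants ℓ F) F := .of_comp (ZMod ℓ) _ _
    exact finiteDimensional_adjoin_simple htr'.le (transcendental_of_notMem hx)

end Constants

/-! ### Valuations of primes and weak approximation -/

section Valuation

variable {F : Type*} [Field F]

/-- The normalized multiplicative valuation of a prime. -/
def val (v : Prime F) : Valuation F ℤᵐ⁰ :=
  (IsDiscreteValuationRing.maximalIdeal v.ring).valuation F

theorem ord_eq (v : Prime F) (g : F) : ord v g = -log (val v g) := rfl

theorem val_eq_exp (v : Prime F) {g : F} (hg : g ≠ 0) : val v g = exp (-ord v g) := by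
  rw [ord_eq, neg_neg, exp_log ((val v).ne_zero_iff.mpr hg)]

theorem val_le_one_iff {v : Prime F} {g : F} : val v g ≤ 1 ↔ g ∈ v.ring := by
  constructor
  · intro h
    obtain ⟨a, ha⟩ := IsDiscreteValuationRing.exists_lift_of_le_one h
    rw [← ha]
    exact a.2
  · intro h
    exact (IsDiscreteValuationRing.maximalIdeal v.ring).valuation_le_one (K := F) ⟨g, h⟩

theorem val_lt_one_iff {v : Prime F} (a : v.ring) :
    val v a < 1 ↔ IsLocalRing.residue v.ring a = 0 := by
  rw [IsLocalRing.residue_eq_zero_iff]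
  exact (IsDiscreteValuationRing.maximalIdeal v.ring).valuation_lt_one_iff_mem a

theorem exists_val_eq (v : Prime F) (n : ℤ) : ∃ g : F, g ≠ 0 ∧ val v g = exp n := by
  obtain ⟨π, hπ⟩ :=
    (IsDiscreteValuationRing.maximalIdeal v.ring).valuation_exists_uniformizer F
  have hπ' : val v π = exp (-1 : ℤ) := hπ
  have h0 : π ≠ 0 := by
    rintro rfl
    rw [map_zero] at hπ'
    exact exp_ne_zero hπ'.symm
  refine ⟨π ^ (-n), zpow_ne_zero _ h0, ?_⟩
  rw [map_zpow₀, hπ', ← exp_zsmul]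
  simp

theorem Prime.ext_ring {v w : Prime F} (h : v.ring = w.ring) : v = w := by
  cases v
  cases w
  congr

/-- Units at `v` are units at `w`, so `val w` is determined by its value at a uniformizer `π` of
`v`; that value is below `1` because `val w` is nontrivial. -/
theorem Prime.eq_of_le {v w : Prime F} (h : v.ring ≤ w.ring) : v = w := by
  refine Prime.ext_ring (le_antisymm h fun g hg => ?_)
  by_cases hg0 : g = 0
  · exact hg0 ▸ v.ring.zero_mem
  obtain ⟨π, hπ0, hπ⟩ := exists_val_eq v (-1)
  obtain ⟨n, hn⟩ : ∃ n : ℤ, val v g = exp n := ⟨_, val_eq_exp v hg0⟩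
  have hle : ∀ {a : F}, val v a ≤ 1 → val w a ≤ 1 :=
    fun ha => val_le_one_iff.mpr (h (val_le_one_iff.mp ha))
  have hunit : ∀ {a : F} (m : ℤ), a ≠ 0 → val v a = exp m → val w a = val w π ^ (-m) := by
    intro a m ha0 ha
    have h1 : val v (a * π ^ m) = 1 := by
      rw [map_mul, map_zpow₀, ha, hπ, ← exp_zsmul, ← exp_add]
      simp
    have h2 : val v (a * π ^ m)⁻¹ = 1 := by rw [map_inv₀, h1, inv_one]
    have h3 : val w (a * π ^ m) = 1 := by
      refine le_antisymm (hle h1.le) ?_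
      have h4 := hle h2.le
      rwa [← (val w).one_le_val_iff (mul_ne_zero ha0 (zpow_ne_zero _ hπ0))] at h4
    rw [map_mul, map_zpow₀] at h3
    rw [zpow_neg]
    exact eq_inv_of_mul_eq_one_left h3
  have hπw : val w π < 1 := by
    refine lt_of_le_of_ne (hle (hπ.le.trans (by rw [← exp_zero, exp_le_exp]; simp))) fun h1 => ?_
    obtain ⟨b, hb0, hb⟩ := exists_val_eq w 1
    have h2 := hunit _ hb0 (val_eq_exp v hb0)
    rw [h1, one_zpow, hb, ← exp_zero, exp_inj] at h2
    omega
  rw [← val_le_one_iff] at hg ⊢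
  rw [hunit n hg0 hn] at hg
  rw [hn, ← exp_zero, exp_le_exp]
  by_contra! hn0
  exact hg.not_gt (one_lt_zpow_of_neg₀ (zero_lt_iff.mpr ((val w).ne_zero_iff.mpr hπ0)) hπw
    (by omega))

theorem exists_val_lt_one_lt {v w : Prime F} (h : v ≠ w) :
    ∃ g : F, val v g < 1 ∧ 1 < val w g := by
  obtain ⟨a, hav, haw⟩ := SetLike.not_le_iff_exists.mp fun hle => h (Prime.eq_of_le hle)
  obtain ⟨b, hbw, hbv⟩ := SetLike.not_le_iff_exists.mp fun hle => h (Prime.eq_of_le hle).symm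
  rw [← val_le_one_iff] at hav haw hbv hbw
  rw [not_le] at haw hbv
  have hb : b ≠ 0 := by
    rintro rfl
    simp at hbv
  refine ⟨a / b, ?_, ?_⟩
  · rw [map_div₀]
    exact (div_lt_one₀ (zero_lt_one.trans hbv)).mpr (hav.trans_lt hbv)
  · rw [map_div₀]
    exact (one_lt_div₀ (zero_lt_iff.mpr ((val w).ne_zero_iff.mpr hb))).mpr (hbw.trans_lt haw)

theorem exists_val_lt_one_forall_one_lt (v : Prime F) (S : Finset (Prime F)) (hv : v ∉ S) :
    ∃ g : F, val v g < 1 ∧ ∀ w ∈ S, 1 < val w g := by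
  classical
  induction S using Finset.induction_on with
  | empty => exact ⟨0, by simp, by simp⟩
  | insert w S hw ih =>
    rw [Finset.mem_insert, not_or] at hv
    obtain ⟨g, hgv, hgS⟩ := ih hv.2
    obtain ⟨h, hhv, hhw⟩ := exists_val_lt_one_lt hv.1
    -- With `r` above every `|log (val u g)|`, the values of `g` and `h ^ r` at `u` can agree only
    -- if both logarithms vanish. Otherwise the sum takes the larger value, without cancellation.
    set r : ℕ := 1 + ∑ u ∈ insert w S, (log (val u g)).natAbs with hr
    have hne : ∀ u ∈ insert w S, (1 < val u g ∨ 1 < val u h) → 1 < val u (g + h ^ r) := by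
      intro u hu hor
      have hlr : (log (val u g)).natAbs < r := by
        have := Finset.single_le_sum (f := fun u => (log (val u g)).natAbs)
          (fun _ _ => Nat.zero_le _) hu
        omega
      have hdist : val u g ≠ val u (h ^ r) := by
        intro heq
        rw [map_pow] at heq
        have hlog := congrArg log heq
        rw [log_pow] at hlog
        rw [hlog, nsmul_eq_mul, Int.natAbs_mul, Int.natAbs_natCast] at hlr
        have h0 : log (val u h) = 0 := by
          by_contra hc
          have : 0 < (log (val u h)).natAbs := Int.natAbs_pos.mpr hc
          nlinarith
        rw [h0, smul_zero] at hlog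
        rcases hor with h1 | h1
        · have := (log_lt_log one_ne_zero (zero_lt_one.trans h1).ne').mpr h1
          rw [log_one, hlog] at this
          exact this.false
        · have := (log_lt_log one_ne_zero (zero_lt_one.trans h1).ne').mpr h1
          rw [log_one, h0] at this
          exact this.false
      rw [(val u).map_add_of_distinct_val hdist, lt_max_iff, map_pow]
      exact hor.imp_right fun h1 => one_lt_pow₀ h1 (by omega)
    refine ⟨g + h ^ r, ?_, fun u hu => hne u hu ?_⟩
    · refine (val v).map_add_lt hgv ?_
      rw [map_pow]
      exact pow_lt_one₀ zero_le hhv (by omega)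
    · rcases Finset.mem_insert.mp hu with rfl | hu
      · exact Or.inr hhw
      · exact Or.inl (hgS u hu)

/-- The function `1 / (1 + g ^ N)` is close to `1` where `g` is small and close to `0` where `g` is
large. -/
theorem exists_val_sub_one_le (v : Prime F) (S : Finset (Prime F)) (hv : v ∉ S) (N : ℕ) :
    ∃ e : F, val v (e - 1) ≤ exp (-(N : ℤ)) ∧ ∀ w ∈ S, val w e ≤ exp (-(N : ℤ)) := by
  obtain ⟨g, hgv, hgS⟩ := exists_val_lt_one_forall_one_lt v S hv
  have hpow : ∀ a : ℤᵐ⁰, a < 1 → a ^ N ≤ exp (-(N : ℤ)) := by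
    intro a ha
    rcases eq_or_ne a 0 with rfl | h0
    · rcases N.eq_zero_or_pos with rfl | hN
      · simp
      · simp [hN.ne']
    · rw [← exp_log h0] at ha ⊢
      rw [← exp_zero, exp_lt_exp] at ha
      rw [← exp_nsmul, exp_le_exp, nsmul_eq_mul]
      nlinarith [Int.natCast_nonneg N]
  rcases N.eq_zero_or_pos with rfl | hN
  · exact ⟨1, by simp, by simp⟩
  have hv1 : val v (1 + g ^ N) = 1 :=
    (val v).map_one_add_of_lt (by rw [map_pow]; exact pow_lt_one₀ zero_le hgv hN.ne')
  have h0 : 1 + g ^ N ≠ 0 := by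
    intro h
    rw [h, map_zero] at hv1
    exact zero_ne_one hv1
  refine ⟨(1 + g ^ N)⁻¹, ?_, fun w hw => ?_⟩
  · have : (1 + g ^ N)⁻¹ - 1 = -(g ^ N / (1 + g ^ N)) := by
      field_simp
      ring
    rw [this, (val v).map_neg, map_div₀, hv1, div_one, map_pow]
    exact hpow _ hgv
  · have h1 : 1 < val w (g ^ N) := by rw [map_pow]; exact one_lt_pow₀ (hgS w hw) hN.ne'
    rw [map_inv₀, (val w).map_add_eq_of_lt_right (by rwa [map_one]), map_pow, ← inv_pow]
    exact hpow _ (inv_lt_one_of_one_lt₀ (hgS w hw))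

/-- Weak approximation at finitely many primes. -/
theorem exists_val_sub_le (S : Finset (Prime F)) (a : Prime F → F) (N : ℤ) :
    ∃ z : F, ∀ v ∈ S, val v (z - a v) ≤ exp N := by
  classical
  set C : ℤ := ∑ v ∈ S, ∑ w ∈ S, |log (val w (a v))| with hC
  have hbound : ∀ v ∈ S, ∀ w ∈ S, val w (a v) ≤ exp C := by
    intro v hv w hw
    rcases eq_or_ne (val w (a v)) 0 with h0 | h0
    · rw [h0]
      exact zero_le
    rw [← log_le_iff_le_exp h0]
    refine (le_abs_self _).trans ?_
    refine (Finset.single_le_sum (f := fun w => |log (val w (a v))|) (fun _ _ => abs_nonneg _)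
      hw).trans ?_
    exact Finset.single_le_sum (f := fun v => ∑ w ∈ S, |log (val w (a v))|)
      (fun _ _ => Finset.sum_nonneg fun _ _ => abs_nonneg _) hv
  choose e he1 he2 using fun v => exists_val_sub_one_le v (S.erase v) (Finset.notMem_erase v S)
    (C - N).toNat
  refine ⟨∑ v ∈ S, e v * a v, fun w hw => ?_⟩
  have hmul : ∀ v ∈ S, ∀ b, val w b ≤ exp (-((C - N).toNat : ℤ)) → val w (b * a v) ≤ exp N := by
    intro v hv b hb
    rw [map_mul]
    refine (mul_le_mul' hb (hbound v hv w hw)).trans ?_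
    rw [← exp_add, exp_le_exp]
    have := Int.self_le_toNat (C - N)
    linarith
  rw [← Finset.add_sum_erase S _ hw, add_sub_right_comm]
  refine (val w).map_add_le ?_ ((val w).map_sum_le fun v hv => ?_)
  · have : e w * a w - a w = (e w - 1) * a w := by ring
    rw [this]
    exact hmul w hw _ (he1 w)
  · obtain ⟨hne, hvS⟩ := Finset.mem_erase.mp hv
    exact hmul v hvS _ (he2 v w (Finset.mem_erase.mpr ⟨hne.symm, hw⟩))

end Valuation

/-! ### Existence of poles -/

section Places

variable {ℓ : ℕ} [Fact ℓ.Prime] {F : Type*} [Field F] [Algebra (ZMod ℓ) F]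

theorem val_constant (v : Prime F) {c : F} (hc : c ∈ constants ℓ F) (h0 : c ≠ 0) : val v c = 1 := by
  have h : ∀ c ∈ constants ℓ F, val v c ≤ 1 :=
    fun c hc => val_le_one_iff.mpr (constants_mem ℓ v ⟨c, hc⟩)
  refine le_antisymm (h c hc) ?_
  rw [(val v).one_le_val_iff h0]
  exact h _ (inv_mem hc)

theorem notMem_constants_of_val_ne_one (v : Prime F) {x : F} (h0 : x ≠ 0) (h : val v x ≠ 1) :
    x ∉ constants ℓ F :=
  fun hx => h (val_constant v hx h0)

/-- Every nonconstant function has a pole. -/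
theorem exists_one_lt_val [IsGlobal ℓ F] {x : F} (hx : x ∉ constants ℓ F) :
    ∃ v : Prime F, 1 < val v x := by
  have hint : x ∉ integralClosure (constants ℓ F) F := fun h =>
    hx (mem_constants_of_isAlgebraic (IsIntegral.isAlgebraic h))
  obtain ⟨V, hκ, hxV⟩ : ∃ V : ValuationSubring F,
      (constants ℓ F).toSubfield.toSubring ≤ V.toSubring ∧ x ∉ V := by
    have : IsIntegrallyClosedIn (constants ℓ F).toSubfield.toSubring F := by
      rw [Subring.isIntegrallyClosedIn_iff]
      intro y hy
      exact mem_constants_of_isAlgebraic (ℓ := ℓ) (IsIntegral.isAlgebraic hy)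
    exact Subring.exists_le_valuationSubring_of_isIntegrallyClosedIn hx
  have hone : ∀ c : constants ℓ F, c ≠ 0 →
      V.valuation (algebraMap (constants ℓ F) F c) = 1 := by
    intro c hc
    refine le_antisymm ((V.valuation_le_one_iff _).mpr (hκ c.2)) ?_
    rw [V.valuation.one_le_val_iff (by simpa using hc)]
    exact (V.valuation_le_one_iff _).mpr (hκ ((constants ℓ F).inv_mem c.2))
  -- An infinite divisor chain would give infinitely many elements independent over `κ(f 1)`, over
  -- which `F` is finite. The chain is started at `f 1` because `f 0` may be zero.
  have hwf : WfDvdMonoid V := by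
    refine ⟨wellFounded_iff_isEmpty_descending_chain.mpr ⟨fun ⟨f, hf⟩ => ?_⟩⟩
    have hne : ∀ n, (f (n + 1) : F) ≠ 0 := fun n => by simpa using (hf n).1
    have hpos : ∀ n, 0 < V.valuation (f (n + 1)) :=
      fun n => zero_lt_iff.mpr (V.valuation.ne_zero_iff.mpr (hne n))
    have hlt : ∀ n, V.valuation (f (n + 1)) < V.valuation (f (n + 2)) := by
      intro n
      obtain ⟨-, y, hy, h⟩ := hf (n + 1)
      rw [h]
      push_cast
      rw [map_mul]
      exact mul_lt_of_lt_one_right (hpos (n + 1)) ((V.valuation_lt_one_iff y).mp hy)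
    have hone' : ∀ n, V.valuation (f (n + 1)) < 1 := fun n =>
      (hlt n).trans_le ((V.valuation_le_one_iff _).mpr (f (n + 2)).2)
    have hx' : (f 1 : F) ∉ constants ℓ F := fun h =>
      (hone' 0).ne (hone ⟨_, h⟩ fun h0 => hne 0 (congrArg Subtype.val h0))
    have := IsGlobal.finite_adjoin _ hx'
    have hind := linearIndependent_of_strictMono_valuation V.valuation hone
      (fun n => (f (n + 1) : F)) (hne 0) hone' (strictMono_nat_of_lt_succ hlt)
    exact not_finite_iff_infinite.mpr inferInstance hind.finite
  have hpid : IsPrincipalIdealRing V := (IsBezout.TFAE.out 3 1).mp hwf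
  have hfield : ¬ IsField V := by
    intro hV
    have hx0 : x ≠ 0 := by
      rintro rfl
      exact hxV V.zero_mem
    have hinv : x⁻¹ ∈ V := (V.mem_or_inv_mem x).resolve_left hxV
    obtain ⟨b, hb⟩ := hV.mul_inv_cancel (a := ⟨x⁻¹, hinv⟩)
      fun h => inv_ne_zero hx0 (congrArg Subtype.val h)
    have hb' : x⁻¹ * (b : F) = 1 := congrArg Subtype.val hb
    exact hxV (by rw [← inv_inv x, ← eq_inv_of_mul_eq_one_right hb']; exact b.2)
  have hdvr : IsDiscreteValuationRing V :=
    { not_a_field' := fun h => hfield (IsLocalRing.isField_iff_maximalIdeal_eq.mpr h) }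
  exact ⟨⟨V, hdvr⟩, not_le.mp fun h => hxV (val_le_one_iff.mp h)⟩

end Places

/-! ### Spaces of functions with bounded poles, and their indices -/

section Space

variable (ℓ : ℕ) [Fact ℓ.Prime] {F : Type*} [Field F] [Algebra (ZMod ℓ) F]

/-- The functions `z` with `ord_v(z) ≥ -D(v)` at all primes `v` in `S`. -/
def space (S : Set (Prime F)) (D : Divisor F) : Submodule (constants ℓ F) F where
  carrier := {z | ∀ v ∈ S, val v z ≤ exp (D v)}
  add_mem' hx hy v hv := (val v).map_add_le (hx v hv) (hy v hv)
  zero_mem' v _ := by simp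
  smul_mem' c x hx v hv := by
    rw [Algebra.smul_def, map_mul]
    refine (mul_le_of_le_one_left' ?_).trans (hx v hv)
    exact val_le_one_iff.mpr (constants_mem ℓ v c)

variable {ℓ}

theorem mem_space {S : Set (Prime F)} {D : Divisor F} {z : F} :
    z ∈ space ℓ S D ↔ ∀ v ∈ S, val v z ≤ exp (D v) := Iff.rfl

theorem space_mono (S : Set (Prime F)) {D E : Divisor F} (h : D ≤ E) :
    space ℓ S D ≤ space ℓ S E :=
  fun _ hz v hv => (hz v hv).trans (exp_le_exp.mpr (h v))

theorem exp_lt_exp_add_one_iff {a : ℤᵐ⁰} {m : ℤ} : a < exp (m + 1) ↔ a ≤ exp m := by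
  rcases eq_or_ne a 0 with rfl | h
  · simp
  · rw [← exp_log h, exp_lt_exp, exp_le_exp, Int.lt_add_one_iff]

/-- The leading coefficient at `v ∈ S` of functions with `ord_v ≥ -(D(v) + 1)`. -/
theorem exists_leadingCoeff {S : Set (Prime F)} (D : Divisor F) {v : Prime F} (hv : v ∈ S) :
    ∃ φ : (space ℓ S (D + Finsupp.single v 1)).toAddSubgroup →+ IsLocalRing.ResidueField v.ring,
      φ.ker = (space ℓ S D).toAddSubgroup.addSubgroupOf _ ∧
      (S.Finite → Function.Surjective φ) := by
  -- Dividing by `b`, which has the largest pole allowed at `v`, turns the leading coefficient into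
  -- a residue.
  obtain ⟨b, hb0, hb⟩ := exists_val_eq v (D v + 1)
  have hDv : (D + Finsupp.single v 1 : Divisor F) v = D v + 1 := by simp
  have hDw : ∀ w, w ≠ v → (D + Finsupp.single v 1 : Divisor F) w = D w := fun w hw => by
    simp [hw.symm]
  have hmem : ∀ z : (space ℓ S (D + Finsupp.single v 1)).toAddSubgroup, (z : F) / b ∈ v.ring := by
    intro z
    have h := z.2 v hv
    rw [hDv] at h
    rw [← val_le_one_iff, map_div₀, hb]
    exact div_le_one_of_le₀ h zero_le
  let φ : (space ℓ S (D + Finsupp.single v 1)).toAddSubgroup →+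
      IsLocalRing.ResidueField v.ring :=
    (IsLocalRing.residue v.ring).toAddMonoidHom.comp
      { toFun := fun z => ⟨(z : F) / b, hmem z⟩
        map_zero' := Subtype.ext (by simp)
        map_add' := fun y z => Subtype.ext (by simp [add_div]) }
  have hφ : ∀ z, φ z = IsLocalRing.residue v.ring ⟨(z : F) / b, hmem z⟩ := fun z => rfl
  refine ⟨φ, ?_, fun hS a => ?_⟩
  · ext z
    rw [AddMonoidHom.mem_ker, hφ, ← val_lt_one_iff, AddSubgroup.mem_addSubgroupOf, map_div₀, hb,
      div_lt_one₀ (by simp), exp_lt_exp_add_one_iff]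
    refine ⟨fun h w hw => ?_, fun h => h v hv⟩
    rcases eq_or_ne w v with rfl | hwv
    · exact h
    · exact (z.2 w hw).trans_eq (by rw [hDw w hwv])
  · classical
    obtain ⟨a, rfl⟩ := IsLocalRing.residue_surjective a
    set t : Prime F → F := fun w => if w = v then a * b else 0 with ht
    obtain ⟨N, hN⟩ : ∃ N : ℤ, ∀ w ∈ hS.toFinset, N ≤ D w := by
      obtain ⟨N, hN⟩ := (hS.toFinset.image D).bddBelow
      exact ⟨N, fun w hw => hN (Finset.mem_coe.mpr (Finset.mem_image_of_mem _ hw))⟩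
    -- Surjectivity: `z` approximates `a * b` at `v` and `0` at the rest of `S`, so it obeys the
    -- pole bounds and has leading coefficient `a`.
    obtain ⟨z, hz⟩ := exists_val_sub_le hS.toFinset t N
    have hzS : ∀ w ∈ S, val w (z - t w) ≤ exp (D w) := fun w hw =>
      (hz w (hS.mem_toFinset.mpr hw)).trans
        (exp_le_exp.mpr (hN w (hS.mem_toFinset.mpr hw)))
    have hzv : val v (z - a * b) ≤ exp (D v) := by simpa [ht] using hzS v hv
    have hzmem : z ∈ space ℓ S (D + Finsupp.single v 1) := by
      intro w hw
      rcases eq_or_ne w v with rfl | hwv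
      · rw [hDv]
        have h1 : val w (a * b) ≤ exp (D w + 1) := by
          rw [map_mul, hb]
          exact mul_le_of_le_one_left' (val_le_one_iff.mpr a.2)
        simpa using (val w).map_add_le (hzv.trans (exp_le_exp.mpr (by simp))) h1
      · rw [hDw w hwv]
        simpa [ht, hwv] using hzS w hw
    refine ⟨⟨z, hzmem⟩, ?_⟩
    rw [hφ, ← sub_eq_zero, ← map_sub, ← val_lt_one_iff]
    have : ((⟨z / b, hmem ⟨z, hzmem⟩⟩ - a : v.ring) : F) = (z - a * b) / b := by
      push_cast
      field_simp
    rw [this, map_div₀, hb, div_lt_one₀ (by simp)]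
    exact exp_lt_exp_add_one_iff.mpr hzv

theorem space_add_single_of_notMem {S : Set (Prime F)} (D : Divisor F) {v : Prime F} (hv : v ∉ S) :
    space ℓ S (D + Finsupp.single v 1) = space ℓ S D := by
  ext z
  refine forall₂_congr fun w hw => ?_
  have : v ≠ w := fun h => hv (h ▸ hw)
  simp [this]

theorem degree_single (v : Prime F) (n : ℤ) :
    degree ℓ F (Finsupp.single v n) = n * primeDegree ℓ v := by
  simp [degree]

theorem effective_induction {p : Divisor F → Prop} (zero : p 0)
    (add_single : ∀ D v, 0 ≤ D → p D → p (D + Finsupp.single v 1)) {D : Divisor F} (hD : 0 ≤ D) :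
    p D := by
  suffices h : ∀ B : Prime F →₀ ℕ, ∀ D : Divisor F, 0 ≤ D → p D →
      0 ≤ D + B.mapRange (Nat.cast : ℕ → ℤ) Nat.cast_zero ∧
        p (D + B.mapRange (Nat.cast : ℕ → ℤ) Nat.cast_zero) by
    have hB : (D.mapRange Int.toNat Int.toNat_zero).mapRange (Nat.cast : ℕ → ℤ) Nat.cast_zero
        = D := by
      ext v
      simpa using hD v
    have := (h (D.mapRange Int.toNat Int.toNat_zero) 0 le_rfl zero).2
    rwa [zero_add, hB] at this
  intro B
  induction B using Finsupp.induction_linear with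
  | zero => exact fun D hD hp => by simpa using ⟨hD, hp⟩
  | add B C hB hC =>
    intro D hD hp
    rw [Finsupp.mapRange_add (by simp), ← add_assoc]
    obtain ⟨h1, h2⟩ := hB D hD hp
    exact hC _ h1 h2
  | single v n =>
    intro D hD hp
    rw [Finsupp.mapRange_single]
    induction n with
    | zero => simpa using ⟨hD, hp⟩
    | succ n ih =>
      rw [Nat.cast_succ, Finsupp.single_add, ← add_assoc]
      exact ⟨add_nonneg ih.1 (by simp), add_single _ _ ih.1 ih.2⟩

variable [IsGlobal ℓ F]

instance : Finite (constants ℓ F) := IsGlobal.finite_constants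

theorem one_lt_card_constants : 1 < Nat.card (constants ℓ F) := Finite.one_lt_card

/-- Multiplication by `x` carries the larger space into the smaller one, so the quotient is a
`κ`-space of dimension at most `[F : κ(x)]`. -/
theorem relIndex_space_eq_of_finrank {S : Set (Prime F)} {x : F} (hx : x ∉ constants ℓ F)
    {D E : Divisor F} (hDE : D ≤ E) (hxD : ∀ v ∈ S, val v x ≤ exp (D v - E v)) :
    ∃ m ≤ Module.finrank (constants ℓ F)⟮x⟯ F,
      (space ℓ S D).toAddSubgroup.relIndex (space ℓ S E).toAddSubgroup =
        Nat.card (constants ℓ F) ^ m := by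
  have := IsGlobal.finite_adjoin x hx
  have hx0 : x ≠ 0 := fun h => hx (h ▸ zero_mem _)
  obtain ⟨h1, h2⟩ := finrank_quotient_le_finrank_adjoin hx0 (space ℓ S E) (space ℓ S D)
    (fun r hr v hv => by
      rw [map_mul]
      refine (mul_le_mul' (hxD v hv) (hr v hv)).trans_eq ?_
      rw [← exp_add, sub_add_cancel]) (space_mono S hDE)
  refine ⟨_, h2, ?_⟩
  rw [← Module.natCard_eq_pow_finrank (K := constants ℓ F)]
  rfl

/-- With `S = {v}`, the leading coefficient identifies the residue field with a quotient of two
spaces, which is finite by the previous lemma applied to a uniformizer. -/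
theorem finite_residueField (ℓ : ℕ) [Fact ℓ.Prime] [Algebra (ZMod ℓ) F] [IsGlobal ℓ F]
    (v : Prime F) :
    Finite (IsLocalRing.ResidueField v.ring) := by
  obtain ⟨x, hx0, hx⟩ := exists_val_eq v (-1)
  have hxκ : x ∉ constants ℓ F := by
    refine notMem_constants_of_val_ne_one v hx0 ?_
    rw [hx, ← exp_zero, Ne, exp_inj]
    simp
  obtain ⟨φ, hker, hφ⟩ := exists_leadingCoeff (ℓ := ℓ) (S := {v}) 0 (Set.mem_singleton v)
  obtain ⟨m, -, hm⟩ := relIndex_space_eq_of_finrank (S := {v}) hxκ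
    (D := 0) (E := 0 + Finsupp.single v 1) (by simp) (by
      intro w hw
      rw [Set.mem_singleton_iff.mp hw, hx]
      simp)
  rw [AddSubgroup.relIndex, ← hker, AddSubgroup.index_ker,
    AddMonoidHom.range_eq_top.mpr (hφ (Set.finite_singleton v))] at hm
  have hcard : Nat.card (IsLocalRing.ResidueField v.ring) ≠ 0 := by
    rw [← AddSubgroup.card_top, hm]
    exact pow_ne_zero _ (zero_lt_one.trans one_lt_card_constants).ne'
  exact Nat.finite_of_card_ne_zero hcard

theorem card_residueField (v : Prime F) :
    Nat.card (IsLocalRing.ResidueField v.ring) =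
      Nat.card (constants ℓ F) ^ primeDegree ℓ v := by
  have := finite_residueField ℓ v
  exact Module.natCard_eq_pow_finrank

theorem primeDegree_pos (v : Prime F) : 0 < primeDegree ℓ v := by
  have := finite_residueField ℓ v
  exact Module.finrank_pos

theorem relIndex_space_add_single (S : Set (Prime F)) (D : Divisor F) (v : Prime F) :
    (space ℓ S D).toAddSubgroup.relIndex (space ℓ S (D + Finsupp.single v 1)).toAddSubgroup ≠ 0 ∧
    (space ℓ S D).toAddSubgroup.relIndex (space ℓ S (D + Finsupp.single v 1)).toAddSubgroup ≤
      Nat.card (constants ℓ F) ^ primeDegree ℓ v ∧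
    (S.Finite → v ∈ S →
      (space ℓ S D).toAddSubgroup.relIndex (space ℓ S (D + Finsupp.single v 1)).toAddSubgroup =
        Nat.card (constants ℓ F) ^ primeDegree ℓ v) := by
  have := finite_residueField ℓ v
  by_cases hv : v ∈ S
  · obtain ⟨φ, hker, hφ⟩ := exists_leadingCoeff (ℓ := ℓ) D hv
    rw [AddSubgroup.relIndex, ← hker, AddSubgroup.index_ker, ← card_residueField]
    refine ⟨Nat.card_pos.ne', Nat.card_le_card_of_injective _ Subtype.val_injective, ?_⟩
    intro hS _
    rw [AddMonoidHom.range_eq_top.mpr (hφ hS), AddSubgroup.card_top]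
  · rw [space_add_single_of_notMem D hv, AddSubgroup.relIndex_self]
    exact ⟨one_ne_zero, Nat.one_le_pow _ _ (zero_lt_one.trans one_lt_card_constants),
      fun _ h => absurd h hv⟩

/-- Primes are added one at a time. An index different from `0` means a finite one. With `S =
Set.univ` this bounds the growth of `L(D)`; for finite `S` weak approximation makes the bound exact.
-/
theorem exists_relIndex_space (S : Set (Prime F)) (D : Divisor F) {B : Divisor F} (hB : 0 ≤ B) :
    ∃ m : ℕ, degree ℓ F B = m ∧
      (space ℓ S D).toAddSubgroup.relIndex (space ℓ S (D + B)).toAddSubgroup ≠ 0 ∧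
      (space ℓ S D).toAddSubgroup.relIndex (space ℓ S (D + B)).toAddSubgroup ≤
        Nat.card (constants ℓ F) ^ m ∧
      (S.Finite → (∀ v ∉ S, B v = 0) →
        (space ℓ S D).toAddSubgroup.relIndex (space ℓ S (D + B)).toAddSubgroup =
          Nat.card (constants ℓ F) ^ m) := by
  refine effective_induction (p := fun B => ∃ m : ℕ, degree ℓ F B = m ∧
      (space ℓ S D).toAddSubgroup.relIndex (space ℓ S (D + B)).toAddSubgroup ≠ 0 ∧
      (space ℓ S D).toAddSubgroup.relIndex (space ℓ S (D + B)).toAddSubgroup ≤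
        Nat.card (constants ℓ F) ^ m ∧
      (S.Finite → (∀ v ∉ S, B v = 0) →
        (space ℓ S D).toAddSubgroup.relIndex (space ℓ S (D + B)).toAddSubgroup =
          Nat.card (constants ℓ F) ^ m)) ⟨0, by simp⟩ (fun B v hB ih => ?_) hB
  · obtain ⟨m, hm, h1, h2, h3⟩ := ih
    obtain ⟨g1, g2, g3⟩ := relIndex_space_add_single (ℓ := ℓ) S (D + B) v
    rw [← add_assoc]
    have hmul := AddSubgroup.relIndex_mul_relIndex (space ℓ S D).toAddSubgroup
      (space ℓ S (D + B)).toAddSubgroup (space ℓ S (D + B + Finsupp.single v 1)).toAddSubgroup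
      (space_mono (ℓ := ℓ) S (by simpa using hB)) (space_mono (ℓ := ℓ) S (by simp))
    refine ⟨m + primeDegree ℓ v, ?_, ?_, ?_, fun hS hBS => ?_⟩
    · rw [map_add, hm, degree_single]
      push_cast
      ring
    · rw [← hmul]
      exact mul_ne_zero h1 g1
    · rw [← hmul, pow_add]
      exact Nat.mul_le_mul h2 g2
    · have hvS : v ∈ S := by
        by_contra hv
        have h4 := hBS v hv
        have h5 : 0 ≤ B v := hB v
        rw [Finsupp.add_apply, Finsupp.single_eq_same] at h4
        omega
      rw [← hmul, pow_add, g3 hS hvS, h3 hS fun w hw => ?_]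
      have h4 := hBS w hw
      have h5 : v ≠ w := fun h => hw (h ▸ hvS)
      simpa [h5] using h4

/-- The fundamental inequality `∑ e_v f_v ≤ n`. -/
theorem sum_ord_mul_primeDegree_le {x : F} (hx : x ∉ constants ℓ F) (S : Finset (Prime F))
    (hS : ∀ v ∈ S, val v x < 1) :
    ∑ v ∈ S, ord v x * primeDegree ℓ v ≤ Module.finrank (constants ℓ F)⟮x⟯ F := by
  classical
  have hx0 : x ≠ 0 := fun h => hx (h ▸ zero_mem _)
  set B : Divisor F := ∑ v ∈ S, Finsupp.single v (ord v x) with hBdef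
  have hBv : ∀ v, B v = if v ∈ S then ord v x else 0 := fun v => by
    simp [hBdef, Finsupp.finsetSum_apply, Finsupp.single_apply]
  have hB : 0 ≤ B := by
    intro v
    rw [hBv]
    split_ifs with h
    · have := hS v h
      rw [val_eq_exp v hx0, ← exp_zero, exp_lt_exp] at this
      simp only [Finsupp.coe_zero, Pi.zero_apply]
      omega
    · simp
  -- The same index is computed twice: exactly, as `|κ| ^ deg B`, and as `|κ| ^ k` with `k ≤ [F :
  -- κ(x)]`.
  obtain ⟨m, hm, -, -, h3⟩ := exists_relIndex_space (ℓ := ℓ) (S : Set (Prime F)) (-B) hB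
  obtain ⟨k, hk, hk'⟩ := relIndex_space_eq_of_finrank (S := (S : Set (Prime F))) hx
    (D := -B) (E := -B + B) (by simpa using hB) (by
      intro v hv
      rw [val_eq_exp v hx0]
      simp [hBv, Finset.mem_coe.mp hv])
  rw [h3 S.finite_toSet fun v hv => (hBv v).trans (if_neg hv)] at hk'
  have hmk : m = k := Nat.pow_right_injective one_lt_card_constants hk'
  have hdeg : degree ℓ F B = ∑ v ∈ S, ord v x * primeDegree ℓ v := by
    simp [hBdef, degree_single]
  rw [← hdeg, hm, hmk]
  exact_mod_cast hk

end Space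

/-! ### Degrees of principal divisors -/

section Divisors

variable {ℓ : ℕ} [Fact ℓ.Prime] {F : Type*} [Field F] [Algebra (ZMod ℓ) F]

theorem ord_zero (v : Prime F) : ord v (0 : F) = 0 := by simp [ord]

theorem ord_pow (v : Prime F) (g : F) (n : ℕ) : ord v (g ^ n) = n * ord v g := by
  rw [ord_eq, ord_eq, map_pow, log_pow, nsmul_eq_mul, mul_neg]

theorem ord_constant (v : Prime F) {c : F} (hc : c ∈ constants ℓ F) : ord v c = 0 := by
  rcases eq_or_ne c 0 with rfl | h
  · exact ord_zero v
  · rw [ord_eq, val_constant v hc h, log_one, neg_zero]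

theorem val_lt_one_iff_ord_pos (v : Prime F) {g : F} (hg : g ≠ 0) : val v g < 1 ↔ 0 < ord v g := by
  rw [val_eq_exp v hg, ← exp_zero, exp_lt_exp, neg_lt_zero]

theorem val_le_one_iff_ord_nonneg (v : Prime F) {g : F} (hg : g ≠ 0) :
    val v g ≤ 1 ↔ 0 ≤ ord v g := by
  rw [val_eq_exp v hg, ← exp_zero, exp_le_exp, neg_nonpos]

theorem degree_eq_sum {D : Divisor F} {S : Finset (Prime F)} (hS : D.support ⊆ S) :
    degree ℓ F D = ∑ v ∈ S, D v * primeDegree ℓ v := by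
  simp only [degree, Finsupp.liftAddHom_apply, AddMonoidHom.coe_mulRight]
  exact Finsupp.sum_of_support_subset _ hS _ (by simp)

theorem inv_notMem_constants {x : F} (hx : x ∉ constants ℓ F) : x⁻¹ ∉ constants ℓ F :=
  fun h => hx (by simpa using inv_mem h)

theorem adjoin_simple_inv (x : F) : (constants ℓ F)⟮x⁻¹⟯ = (constants ℓ F)⟮x⟯ := by
  refine le_antisymm (adjoin_simple_le_iff.mpr (inv_mem (mem_adjoin_simple_self _ x)))
    (adjoin_simple_le_iff.mpr ?_)
  simpa using inv_mem (mem_adjoin_simple_self (constants ℓ F) x⁻¹)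

variable [IsGlobal ℓ F]

theorem finite_setOf_ord_pos (x : F) (hx : x ∉ constants ℓ F) : {v | 0 < ord v x}.Finite := by
  by_contra hinf
  have hx0 : x ≠ 0 := fun h => hx (h ▸ zero_mem _)
  obtain ⟨S, hS, hcard⟩ := Set.Infinite.exists_subset_card_eq hinf
    (Module.finrank (constants ℓ F)⟮x⟯ F + 1)
  have h1 := sum_ord_mul_primeDegree_le hx S fun v hv =>
    (val_lt_one_iff_ord_pos v hx0).mpr (hS hv)
  have h2 : (S.card : ℤ) ≤ ∑ v ∈ S, ord v x * primeDegree ℓ v := by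
    rw [Finset.card_eq_sum_ones]
    push_cast
    refine Finset.sum_le_sum fun v hv => ?_
    have h3 : 0 < ord v x := hS hv
    have h4 := primeDegree_pos (ℓ := ℓ) v
    have h5 : (1 : ℤ) ≤ primeDegree ℓ v := by exact_mod_cast h4
    nlinarith
  rw [hcard] at h2
  push_cast at h2
  linarith

theorem finite_setOf_ord_ne_zero (ℓ : ℕ) [Fact ℓ.Prime] [Algebra (ZMod ℓ) F] [IsGlobal ℓ F]
    (x : F) : {v | ord v x ≠ 0}.Finite := by
  by_cases hx : x ∈ constants ℓ F
  · simp [ord_constant (ℓ := ℓ) _ hx]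
  · have hx' : x⁻¹ ∉ constants ℓ F := fun h => hx (by simpa using inv_mem h)
    refine ((finite_setOf_ord_pos x hx).union (finite_setOf_ord_pos _ hx')).subset fun v hv => ?_
    have hv' : ord v x ≠ 0 := hv
    simp only [Set.mem_union, Set.mem_ofPred_eq, ord_inv]
    omega

variable (ℓ) in
/-- The divisor of a function. -/
def divisor (x : F) : Divisor F :=
  Finsupp.ofSupportFinite (fun v => ord v x) (finite_setOf_ord_ne_zero ℓ x)

@[simp]
theorem divisor_apply (x : F) (v : Prime F) : divisor ℓ x v = ord v x := rfl

variable (ℓ) in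
/-- The divisor of poles of a function. -/
def polar (x : F) : Divisor F := divisor ℓ x⁻¹ ⊔ 0

theorem polar_apply (x : F) (v : Prime F) : polar ℓ x v = max (-ord v x) 0 := by
  rw [← ord_inv]
  rfl

theorem polar_nonneg (x : F) : 0 ≤ polar ℓ x := le_sup_right

theorem divisor_eq (x : F) : divisor ℓ x = polar ℓ x⁻¹ - polar ℓ x := by
  ext v
  rw [Finsupp.sub_apply, polar_apply, polar_apply, ord_inv, neg_neg, divisor_apply]
  rcases le_total (ord v x) 0 with h | h
  · rw [max_eq_right h, max_eq_left (by omega)]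
    ring
  · rw [max_eq_left h, max_eq_right (by omega)]
    ring

theorem degree_polar_inv_le {x : F} (hx : x ∉ constants ℓ F) :
    degree ℓ F (polar ℓ x⁻¹) ≤ Module.finrank (constants ℓ F)⟮x⟯ F := by
  have hx0 : x ≠ 0 := fun h => hx (h ▸ zero_mem _)
  rw [degree_eq_sum subset_rfl]
  have hv : ∀ v ∈ (polar ℓ x⁻¹).support, 0 < ord v x := by
    intro v hv
    rw [Finsupp.mem_support_iff, polar_apply, ord_inv, neg_neg] at hv
    by_contra! h
    exact hv (max_eq_right h)
  refine le_trans (le_of_eq (Finset.sum_congr rfl fun v h => ?_)) (sum_ord_mul_primeDegree_le hx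
    (polar ℓ x⁻¹).support fun v h => (val_lt_one_iff_ord_pos v hx0).mpr (hv v h))
  rw [polar_apply, ord_inv, neg_neg, max_eq_left (hv v h).le]

theorem degree_polar_le {x : F} (hx : x ∉ constants ℓ F) :
    degree ℓ F (polar ℓ x) ≤ Module.finrank (constants ℓ F)⟮x⟯ F := by
  have := degree_polar_inv_le (inv_notMem_constants hx)
  rwa [inv_inv, adjoin_simple_inv] at this

theorem mem_space_univ_iff {D : Divisor F} {z : F} (hz : z ≠ 0) :
    z ∈ space ℓ Set.univ D ↔ 0 ≤ divisor ℓ z + D := by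
  rw [mem_space, Finsupp.le_def]
  refine forall_congr' fun v => ?_
  rw [val_eq_exp v hz, exp_le_exp]
  simp only [Set.mem_univ, true_imp_iff, Finsupp.coe_zero, Pi.zero_apply, Finsupp.add_apply,
    divisor_apply]
  constructor <;> intro h <;> linarith

theorem space_zero : (space ℓ Set.univ (0 : Divisor F) : Set F) = constants ℓ F := by
  ext z
  refine ⟨fun hz => ?_, fun hz v _ => ?_⟩
  · by_contra hc
    obtain ⟨v, hv⟩ := exists_one_lt_val hc
    exact hv.not_ge (hz v trivial)
  · exact val_le_one_iff.mpr (constants_mem ℓ v ⟨z, hz⟩)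

/-- The extra `1` in the exponent is the contribution of `L(0) = κ`; a nonzero `Nat.card` records
finiteness. -/
theorem card_space_ne_zero_and_le {D : Divisor F} (hD : 0 ≤ D) :
    ∃ m : ℕ, degree ℓ F D = m ∧ Nat.card (space ℓ Set.univ D) ≠ 0 ∧
      Nat.card (space ℓ Set.univ D) ≤ Nat.card (constants ℓ F) ^ (m + 1) := by
  obtain ⟨m, hm, h1, h2, -⟩ := exists_relIndex_space (ℓ := ℓ) Set.univ 0 hD
  rw [zero_add] at h1 h2
  have hmul := AddSubgroup.relIndex_mul_relIndex ⊥ (space ℓ Set.univ (0 : Divisor F)).toAddSubgroup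
    (space ℓ Set.univ D).toAddSubgroup bot_le (space_mono (ℓ := ℓ) Set.univ hD)
  rw [AddSubgroup.relIndex_bot_left, AddSubgroup.relIndex_bot_left] at hmul
  have h0 : Nat.card (space ℓ Set.univ (0 : Divisor F)).toAddSubgroup =
      Nat.card (constants ℓ F) := Nat.card_congr (Equiv.setCongr space_zero)
  rw [h0] at hmul
  refine ⟨m, hm, ?_, ?_⟩
  · change Nat.card (space ℓ Set.univ D).toAddSubgroup ≠ 0
    rw [← hmul]
    exact mul_ne_zero (zero_lt_one.trans one_lt_card_constants).ne' h1
  · change Nat.card (space ℓ Set.univ D).toAddSubgroup ≤ _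
    rw [← hmul, pow_succ']
    exact Nat.mul_le_mul_left _ h2

/-- The spaces `L(k A + C)`, with `A` the divisor of poles of `x`, grow at least like `n k`. -/
theorem exists_pow_le_card_space {x : F} (hx : x ∉ constants ℓ F) :
    ∃ C : Divisor F, 0 ≤ C ∧ ∀ k : ℕ,
      Nat.card (constants ℓ F) ^ (Module.finrank (constants ℓ F)⟮x⟯ F * (k + 1)) ≤
        Nat.card (space ℓ Set.univ (k • polar ℓ x + C)) := by
  classical
  have := IsGlobal.finite_adjoin x hx
  set n := Module.finrank (constants ℓ F)⟮x⟯ F with hn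
  have hx0 : x ≠ 0 := fun h => hx (h ▸ zero_mem _)
  have : Module.Free (constants ℓ F)⟮x⟯ F := Module.Free.of_divisionRing _ _
  let b := Module.finBasis (constants ℓ F)⟮x⟯ F
  set C : Divisor F := ∑ i, polar ℓ (b i) with hC
  have hC0 : 0 ≤ C := Finset.sum_nonneg fun i _ => polar_nonneg _
  refine ⟨C, hC0, fun k => ?_⟩
  have hb : ∀ i v, val v (b i) ≤ exp (C v) := by
    intro i v
    rw [val_eq_exp v (b.ne_zero i), exp_le_exp]
    have h1 : polar ℓ (b i) ≤ C :=
      Finset.single_le_sum (f := fun i => polar ℓ (b i)) (fun i _ => polar_nonneg _)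
        (Finset.mem_univ i)
    exact ((le_max_left _ _).trans_eq (polar_apply _ _).symm).trans (h1 v)
  have hxp : ∀ (p : (constants ℓ F)[X]) v, p ∈ degreeLT (constants ℓ F) (k + 1) →
      val v (aeval x p) ≤ exp ((k • polar ℓ x) v) := by
    intro p v hp
    rw [mem_degreeLT] at hp
    have hp' : p.natDegree < k + 1 := by
      rcases eq_or_ne p 0 with rfl | h0
      · simp
      · exact (natDegree_lt_iff_degree_lt h0).mpr hp
    rw [aeval_eq_sum_range' hp']
    refine (val v).map_sum_le fun i hi => ?_
    rw [Finset.mem_range, Nat.lt_succ_iff] at hi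
    rw [Algebra.smul_def, map_mul, map_pow]
    refine (mul_le_of_le_one_left' (val_le_one_iff.mpr (constants_mem ℓ v _))).trans ?_
    rw [val_eq_exp v hx0, ← exp_nsmul, exp_le_exp, Finsupp.smul_apply, polar_apply, nsmul_eq_mul,
      nsmul_eq_mul]
    have h1 := le_max_left (-ord v x) 0
    have h2 := le_max_right (-ord v x) 0
    have h3 : (i : ℤ) ≤ k := by exact_mod_cast hi
    calc (i : ℤ) * -ord v x ≤ i * max (-ord v x) 0 := by gcongr
      _ ≤ k * max (-ord v x) 0 := by gcongr
  -- Combinations of a basis over `κ(x)` with coefficients in `κ[x]` of degree at most `k`; `C`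
  -- absorbs the poles of the basis.
  let Φ : (Fin n → degreeLT (constants ℓ F) (k + 1)) →
      space ℓ Set.univ (k • polar ℓ x + C) := fun p =>
    ⟨∑ i, aeval x (p i : (constants ℓ F)[X]) * b i, fun v _ => (val v).map_sum_le fun i _ => by
      rw [map_mul, Finsupp.add_apply, exp_add]
      exact mul_le_mul' (hxp _ v (p i).2) (hb i v)⟩
  have hΦ : Function.Injective Φ := by
    intro p r hpr
    have h1 : ∑ i, (⟨aeval x (p i : (constants ℓ F)[X]),
        algebra_adjoin_le_adjoin _ _ (aeval_mem_adjoin_singleton _ x)⟩ -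
          ⟨aeval x (r i : (constants ℓ F)[X]), algebra_adjoin_le_adjoin _ _ (aeval_mem_adjoin_singleton _ x)⟩ :
          (constants ℓ F)⟮x⟯) • b i = 0 := by
      have h2 : (Φ p : F) = Φ r := congrArg Subtype.val hpr
      simp only [sub_smul, Finset.sum_sub_distrib]
      exact sub_eq_zero.mpr h2
    have h3 := Fintype.linearIndependent_iff.mp b.linearIndependent _ h1
    funext i
    have h4 : aeval x (p i : (constants ℓ F)[X]) = aeval x (r i : (constants ℓ F)[X]) :=
      congrArg Subtype.val (sub_eq_zero.mp (h3 i))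
    exact Subtype.ext (transcendental_iff_injective.mp (transcendental_of_notMem hx) h4)
  obtain ⟨m, -, h0, -⟩ := card_space_ne_zero_and_le (ℓ := ℓ) (D := k • polar ℓ x + C)
    (add_nonneg (nsmul_nonneg (polar_nonneg _) _) hC0)
  have := Nat.finite_of_card_ne_zero h0
  refine le_trans (le_of_eq ?_) (Nat.card_le_card_of_injective Φ hΦ)
  rw [Nat.card_fun, Nat.card_congr (degreeLTEquiv (constants ℓ F) (k + 1)).toEquiv, Nat.card_fun]
  simp [pow_mul, mul_comm n]

/-- The divisor of poles of `x` has degree `[F : κ(x)]`. -/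
theorem degree_polar {x : F} (hx : x ∉ constants ℓ F) :
    degree ℓ F (polar ℓ x) = Module.finrank (constants ℓ F)⟮x⟯ F := by
  refine le_antisymm (degree_polar_le hx) ?_
  obtain ⟨C, hC, h⟩ := exists_pow_le_card_space hx
  set n := Module.finrank (constants ℓ F)⟮x⟯ F
  by_contra! hlt
  obtain ⟨c, hc, -⟩ := card_space_ne_zero_and_le (ℓ := ℓ) hC
  -- If the degree were below `n`, the lower bound `n (k + 1)` would exceed the upper bound `k deg +
  -- c + 1` for large `k`; `k = c + 2` suffices.
  obtain ⟨m, hm, -, hle⟩ := card_space_ne_zero_and_le (ℓ := ℓ) (D := (c + 2) • polar ℓ x + C)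
    (add_nonneg (nsmul_nonneg (polar_nonneg _) _) hC)
  have h1 := (Nat.pow_le_pow_iff_right one_lt_card_constants).mp ((h (c + 2)).trans hle)
  rw [map_add, map_nsmul, hc, nsmul_eq_mul] at hm
  zify at h1
  rw [← hm] at h1
  push_cast at h1
  have h2 : degree ℓ F (polar ℓ x) + 1 ≤ n := hlt
  nlinarith [Int.natCast_nonneg c]

/-- Principal divisors have degree zero. -/
theorem degree_divisor (x : F) : degree ℓ F (divisor ℓ x) = 0 := by
  by_cases hx : x ∈ constants ℓ F
  · have : divisor ℓ x = 0 := by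
      ext v
      simpa using ord_constant v hx
    rw [this, map_zero]
  · rw [divisor_eq, map_sub, degree_polar hx, degree_polar (inv_notMem_constants hx),
      adjoin_simple_inv, sub_self]

end Divisors

/-! ### Finiteness of the class group -/

section ClassGroup

variable {ℓ : ℕ} [Fact ℓ.Prime] {F : Type*} [Field F] [Algebra (ZMod ℓ) F] [IsGlobal ℓ F]

theorem card_space_add_le (D : Divisor F) {B : Divisor F} (hB : 0 ≤ B) {m : ℕ}
    (hm : degree ℓ F B = m) :
    Nat.card (space ℓ Set.univ (D + B)) ≤
      Nat.card (space ℓ Set.univ D) * Nat.card (constants ℓ F) ^ m := by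
  obtain ⟨m', hm', -, h2, -⟩ := exists_relIndex_space (ℓ := ℓ) Set.univ D hB
  obtain rfl : m' = m := by exact_mod_cast hm'.symm.trans hm
  have hmul := AddSubgroup.relIndex_mul_relIndex ⊥ (space ℓ Set.univ D).toAddSubgroup
    (space ℓ Set.univ (D + B)).toAddSubgroup bot_le
    (space_mono (ℓ := ℓ) Set.univ (by simpa using hB))
  rw [AddSubgroup.relIndex_bot_left, AddSubgroup.relIndex_bot_left] at hmul
  change Nat.card (space ℓ Set.univ (D + B)).toAddSubgroup ≤ _
  rw [← hmul]
  exact Nat.mul_le_mul_left _ h2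

theorem exists_ne_zero_of_one_lt_card {D : Divisor F}
    (h : 1 < Nat.card (space ℓ Set.univ D)) : ∃ z : F, z ≠ 0 ∧ 0 ≤ divisor ℓ z + D := by
  have := Nat.finite_of_card_ne_zero (zero_lt_one.trans h).ne'
  have := Finite.one_lt_card_iff_nontrivial.mp h
  obtain ⟨z, hz⟩ := exists_ne (0 : space ℓ Set.univ D)
  have hz' : (z : F) ≠ 0 := fun h => hz (Subtype.ext h)
  exact ⟨z, hz', (mem_space_univ_iff hz').mp z.2⟩

theorem one_lt_of_pow_le_mul_pow {Q a b c : ℕ} (hQ : 1 < Q) (h : Q ^ a ≤ c * Q ^ b) (hab : b < a) :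
    1 < c := by
  by_contra! hc
  have h1 : c * Q ^ b ≤ Q ^ b := (Nat.mul_le_mul_right _ hc).trans_eq (one_mul _)
  exact absurd (h.trans h1) (not_le.mpr (Nat.pow_lt_pow_right hQ hab))

variable (ℓ F) in
/-- Riemann's inequality, in the form: divisors of large degree are equivalent to effective
divisors. -/
theorem exists_forall_le_degree_exists_effective :
    ∃ c : ℕ, ∀ D : Divisor F, c ≤ degree ℓ F D → ∃ z : F, z ≠ 0 ∧ 0 ≤ divisor ℓ z + D := by
  obtain ⟨x, hx⟩ := IsGlobal.exists_notMem (ℓ := ℓ) (F := F)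
  have hQ := one_lt_card_constants (ℓ := ℓ) (F := F)
  set Q := Nat.card (constants ℓ F)
  obtain ⟨C, hC, hgrow⟩ := exists_pow_le_card_space hx
  have hdeg := degree_polar hx
  have := IsGlobal.finite_adjoin x hx
  have hn : 0 < Module.finrank (constants ℓ F)⟮x⟯ F := Module.finrank_pos
  set n := Module.finrank (constants ℓ F)⟮x⟯ F
  obtain ⟨c, hc, -⟩ := card_space_ne_zero_and_le (ℓ := ℓ) hC
  have hA : ∀ k : ℕ, Q ^ (n * (k + 1)) ≤ Nat.card (space ℓ Set.univ (k • polar ℓ x)) * Q ^ c :=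
    fun k => (hgrow k).trans (card_space_add_le _ hC hc)
  refine ⟨c, fun D hD => ?_⟩
  obtain ⟨E, hE, hDE⟩ : ∃ E : Divisor F, 0 ≤ E ∧ D ≤ E := ⟨D ⊔ 0, le_sup_right, le_sup_left⟩
  obtain ⟨e, he, -⟩ := card_space_ne_zero_and_le (ℓ := ℓ) hE
  -- For this `k`, `L(k A - E)` is nonzero, where `A` is the polar divisor of `x`. A nonzero `z` in
  -- it replaces `D` by an equivalent divisor below `k A`, whose space can then be compared with
  -- `L(k A)`.
  set k := c + e
  have h1 : 1 < Nat.card (space ℓ Set.univ (k • polar ℓ x - E)) := by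
    have h := card_space_add_le (k • polar ℓ x - E) hE he
    rw [sub_add_cancel] at h
    refine one_lt_of_pow_le_mul_pow (a := n * (k + 1)) (b := e + c) hQ ?_ (by
      have := Nat.le_mul_of_pos_left (k + 1) hn
      omega)
    rw [pow_add, ← mul_assoc]
    exact (hA k).trans (Nat.mul_le_mul_right _ h)
  obtain ⟨z, hz0, hz⟩ := exists_ne_zero_of_one_lt_card h1
  have hB : 0 ≤ k • polar ℓ x - (D - divisor ℓ z) := by
    refine hz.trans ?_
    rw [← sub_nonneg]
    have : k • polar ℓ x - (D - divisor ℓ z) - (divisor ℓ z + (k • polar ℓ x - E)) = E - D := by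
      abel
    rwa [this, sub_nonneg]
  obtain ⟨m, hm, -⟩ := card_space_ne_zero_and_le (ℓ := ℓ) hB
  have h2 : 1 < Nat.card (space ℓ Set.univ (D - divisor ℓ z)) := by
    have h := card_space_add_le (D - divisor ℓ z) hB hm
    rw [add_sub_cancel] at h
    refine one_lt_of_pow_le_mul_pow (a := n * (k + 1)) (b := m + c) hQ ?_ ?_
    · rw [pow_add, ← mul_assoc]
      exact (hA k).trans (Nat.mul_le_mul_right _ h)
    · rw [map_sub, map_sub, map_nsmul, hdeg, degree_divisor, nsmul_eq_mul] at hm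
      zify
      rw [← hm]
      have : (0 : ℤ) < n := by exact_mod_cast hn
      nlinarith
  obtain ⟨w, hw0, hw⟩ := exists_ne_zero_of_one_lt_card h2
  refine ⟨w * z⁻¹, mul_ne_zero hw0 (inv_ne_zero hz0), hw.trans_eq ?_⟩
  ext v
  simp only [Finsupp.add_apply, Finsupp.sub_apply, divisor_apply, ord_inv,
    ord_mul v hw0 (inv_ne_zero hz0)]
  ring

-- If `x` is a unit at a prime of degree `d`, its residue lies in a field with `Q ^ d` elements, so
-- `x ^ Q ^ d - x` vanishes there. Finitely many functions thus account for all these primes.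
variable (ℓ F) in
theorem finite_setOf_primeDegree_le (m : ℕ) : {v : Prime F | primeDegree ℓ v ≤ m}.Finite := by
  obtain ⟨x, hx⟩ := IsGlobal.exists_notMem (ℓ := ℓ) (F := F)
  have hx0 : x ≠ 0 := fun h => hx (h ▸ zero_mem _)
  set Q := Nat.card (constants ℓ F) with hQ
  have hfin : (⋃ d ∈ Finset.Icc 1 m, {v | ord v (x ^ Q ^ d - x) ≠ 0}).Finite :=
    Set.Finite.biUnion (Finset.finite_toSet _) fun d _ => finite_setOf_ord_ne_zero ℓ _
  refine ((finite_setOf_ord_ne_zero ℓ x).union hfin).subset fun v hv => ?_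
  by_cases hv0 : ord v x = 0
  swap
  · exact Or.inl hv0
  right
  have hxv : x ∈ v.ring := val_le_one_iff.mp ((val_le_one_iff_ord_nonneg v hx0).mpr hv0.ge)
  simp only [Set.mem_iUnion]
  refine ⟨primeDegree ℓ v, Finset.mem_Icc.mpr ⟨primeDegree_pos v, hv⟩, ?_⟩
  have := finite_residueField ℓ v
  have := Fintype.ofFinite (IsLocalRing.ResidueField v.ring)
  have hres : IsLocalRing.residue v.ring (⟨x, hxv⟩ ^ Q ^ primeDegree ℓ v - ⟨x, hxv⟩) = 0 := by
    rw [map_sub, map_pow, hQ, ← card_residueField, Nat.card_eq_fintype_card, FiniteField.pow_card,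
      sub_self]
  rw [← val_lt_one_iff] at hres
  have hne : x ^ Q ^ primeDegree ℓ v - x ≠ 0 := by
    intro h
    refine transcendental_of_notMem hx ⟨X ^ Q ^ primeDegree ℓ v - X, ?_, by simpa using h⟩
    exact FiniteField.X_pow_card_sub_X_ne_zero _
      (Nat.one_lt_pow (primeDegree_pos v).ne' one_lt_card_constants)
  exact ((val_lt_one_iff_ord_pos v hne).mp hres).ne'

-- Such a divisor involves only primes of degree at most `m`, with multiplicities at most `m`.
variable (ℓ F) in
theorem finite_setOf_effective (m : ℕ) :
    {D : Divisor F | 0 ≤ D ∧ degree ℓ F D = m}.Finite := by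
  classical
  set T := (finite_setOf_primeDegree_le ℓ F m).toFinset
  set M : Divisor F := ∑ v ∈ T, Finsupp.single v (m : ℤ) with hM
  have hMv : ∀ v, M v = if v ∈ T then (m : ℤ) else 0 := fun v => by
    simp [hM, Finsupp.finsetSum_apply, Finsupp.single_apply]
  refine (Set.finite_Icc 0 M).subset fun D ⟨hD, hdeg⟩ => ⟨hD, fun v => ?_⟩
  have hDv : ∀ v, 0 ≤ D v := hD
  rw [hMv]
  rcases (hDv v).eq_or_lt with h0 | h0
  · rw [← h0]
    split_ifs <;> simp
  have h1 : D v * primeDegree ℓ v ≤ m := by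
    rw [← hdeg, degree_eq_sum subset_rfl]
    exact Finset.single_le_sum (f := fun v => D v * (primeDegree ℓ v : ℤ))
      (fun w _ => mul_nonneg (hDv w) (Int.natCast_nonneg _))
      (Finsupp.mem_support_iff.mpr h0.ne')
  have h2 : (0 : ℤ) < primeDegree ℓ v := by exact_mod_cast primeDegree_pos v
  have hvT : v ∈ T := by
    simp only [T, Set.Finite.mem_toFinset, Set.mem_ofPred_eq]
    zify
    nlinarith
  rw [if_pos hvT]
  nlinarith

/-- The class number of a global function field is finite. -/
instance : Finite (ClassGroup ℓ F) := by
  obtain ⟨c, hc⟩ := exists_forall_le_degree_exists_effective ℓ F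
  obtain ⟨x, hx⟩ := IsGlobal.exists_notMem (ℓ := ℓ) (F := F)
  obtain ⟨v, -⟩ := exists_one_lt_val hx
  -- Shifting by `D₀` reaches the range of Riemann's inequality: every class is that of `E - D₀`
  -- with `E` effective of degree `deg D₀`.
  set D₀ : Divisor F := Finsupp.single v (c : ℤ) with hD₀
  have hdeg : degree ℓ F D₀ = (c * primeDegree ℓ v : ℕ) := by simp [hD₀, degree_single]
  have hcD₀ : (c : ℤ) ≤ degree ℓ F D₀ := by
    rw [hdeg]
    exact_mod_cast Nat.le_mul_of_pos_right c (primeDegree_pos v)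
  have := (finite_setOf_effective ℓ F (c * primeDegree ℓ v)).to_subtype
  refine Finite.of_surjective
    (fun E : {D : Divisor F | 0 ≤ D ∧ degree ℓ F D = (c * primeDegree ℓ v : ℕ)} =>
      (QuotientAddGroup.mk ⟨E - D₀, by
        rw [AddMonoidHom.mem_ker, map_sub, E.2.2, hdeg, sub_self]⟩ : ClassGroup ℓ F)) fun a => ?_
  obtain ⟨⟨D, hD⟩, rfl⟩ := QuotientAddGroup.mk_surjective a
  rw [AddMonoidHom.mem_ker] at hD
  obtain ⟨z, hz0, hz⟩ := hc (D + D₀) (by rwa [map_add, hD, zero_add])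
  refine ⟨⟨divisor ℓ z + (D + D₀), hz, ?_⟩, ?_⟩
  · rw [map_add, map_add, degree_divisor, hD, hdeg]
    simp
  · rw [QuotientAddGroup.eq, AddSubgroup.mem_addSubgroupOf]
    refine ⟨z⁻¹, inv_ne_zero hz0, fun w => ?_⟩
    simp only [AddSubgroup.coe_add, NegMemClass.coe_neg, Finsupp.add_apply, Finsupp.neg_apply,
      Finsupp.sub_apply, divisor_apply, ord_inv]
    ring

/-- The `a`-torsion lies in the `b`-torsion, and finite sets of equal size, one inside the other,
coincide. -/
theorem nsmul_eq_zero_of_torsionCard_eq {a b : ℕ} (hab : a ∣ b)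
    (h : torsionCard ℓ F b = torsionCard ℓ F a) (c : ClassGroup ℓ F) (hc : b • c = 0) :
    a • c = 0 := by
  have hsub : {c : ClassGroup ℓ F | a • c = 0} ⊆ {c | b • c = 0} := by
    rintro x hx
    obtain ⟨d, rfl⟩ := hab
    rw [Set.mem_ofPred_eq] at hx ⊢
    rw [mul_comm, mul_smul, hx, smul_zero]
  have heq := Set.eq_of_subset_of_ncard_le hsub h.le
  exact heq.ge hc

end ClassGroup

/-! ### Power-divisible divisors and the Fermat-type equation -/

section Equation

variable {ℓ : ℕ} [Fact ℓ.Prime] {F : Type*} [Field F] [Algebra (ZMod ℓ) F]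

theorem constants_mem_integers (P : Prime F) {c : F} (hc : c ∈ constants ℓ F) : c ∈ integers P :=
  fun v _ => constants_mem ℓ v ⟨c, hc⟩

/-- In degree one the residue field is `κ` itself, so every residue lifts to a constant. -/
theorem exists_constant_val_sub_lt_one {P : Prime F} (hP : primeDegree ℓ P = 1) {r : F}
    (hr : r ∈ P.ring) : ∃ β ∈ constants ℓ F, val P (r - β) < 1 := by
  obtain ⟨β, hβ⟩ := (finrank_eq_one_iff_of_nonzero' (K := constants ℓ F)
    (1 : IsLocalRing.ResidueField P.ring) one_ne_zero).mp hP (IsLocalRing.residue _ ⟨r, hr⟩)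
  have hβ' : IsLocalRing.residue P.ring ⟨β, constants_mem ℓ P β⟩ =
      IsLocalRing.residue P.ring ⟨r, hr⟩ := by
    rw [← hβ, Algebra.smul_def, mul_one]
    rfl
  refine ⟨β, β.2, ?_⟩
  have := (val_lt_one_iff (v := P) (⟨r, hr⟩ - ⟨β, constants_mem ℓ P β⟩)).mpr
    (by rw [map_sub, hβ', sub_self])
  exact this

variable [IsGlobal ℓ F]

theorem mem_constants_of_forall_ord_eq_zero {g : F} (h : ∀ v, ord v g = 0) :
    g ∈ constants ℓ F := by
  rcases eq_or_ne g 0 with rfl | hg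
  · exact zero_mem _
  have : g ∈ (space ℓ Set.univ (0 : Divisor F) : Set F) := fun v _ => by
    rw [val_eq_exp v hg, h]
    simp
  rwa [space_zero] at this

theorem ord_eq_neg_sum {P : Prime F} (hP : primeDegree ℓ P = 1) (g : F) :
    ∃ S : Finset (Prime F), P ∉ S ∧ ord P g = -∑ v ∈ S, ord v g * primeDegree ℓ v := by
  classical
  refine ⟨(divisor ℓ g).support.erase P, Finset.notMem_erase _ _, ?_⟩
  have h := degree_divisor (ℓ := ℓ) g
  rw [degree_eq_sum (S := insert P ((divisor ℓ g).support.erase P)) (fun v hv => by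
    by_cases hvP : v = P
    · simp [hvP]
    · exact Finset.mem_insert_of_mem (Finset.mem_erase.mpr ⟨hvP, hv⟩)),
    Finset.sum_insert (Finset.notMem_erase _ _), hP] at h
  simp only [divisor_apply, Nat.cast_one, mul_one] at h
  linarith

/-- The units of the ring of integers are constant. -/
theorem mem_constants_of_inv_mem_integers {P : Prime F} (hP : primeDegree ℓ P = 1) {g : F}
    (hg : g ∈ integers P) (hg' : g⁻¹ ∈ integers P) : g ∈ constants ℓ F := by
  rcases eq_or_ne g 0 with rfl | h0
  · exact zero_mem _
  have h : ∀ v, v ≠ P → ord v g = 0 := fun v hv => by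
    have h1 := (val_le_one_iff_ord_nonneg v h0).mp (val_le_one_iff.mpr (hg v hv))
    have h2 := (val_le_one_iff_ord_nonneg v (inv_ne_zero h0)).mp (val_le_one_iff.mpr (hg' v hv))
    rw [ord_inv] at h2
    omega
  refine mem_constants_of_forall_ord_eq_zero fun v => ?_
  by_cases hv : v = P
  · subst hv
    obtain ⟨S, hPS, hS⟩ := ord_eq_neg_sum hP g
    rw [hS, Finset.sum_eq_zero fun w hw => ?_, neg_zero]
    rw [h w fun e => hPS (e ▸ hw), zero_mul]
  · exact h v hv

/-- A function whose divisor is divisible by `q ^ k` away from a prime of degree one is a constant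
times a `q`-th power. -/
theorem exists_eq_constant_mul_pow {P : Prime F} (hP : primeDegree ℓ P = 1) {q k : ℕ} (hq : 0 < q)
    (hk : 0 < k) (htors : torsionCard ℓ F (q ^ k) = torsionCard ℓ F (q ^ (k - 1))) {g : F}
    (hg : g ≠ 0) (hdvd : ∀ v, v ≠ P → (q ^ k : ℤ) ∣ ord v g) (hgP : g ∈ integers P) :
    ∃ c ∈ constants ℓ F, ∃ z ∈ integers P, g = c * z ^ q := by
  obtain ⟨k, rfl⟩ : ∃ j, k = j + 1 := ⟨k - 1, by omega⟩
  rw [Nat.add_sub_cancel] at htors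
  have hdvd' : ∀ v, (q ^ (k + 1) : ℤ) ∣ ord v g := by
    intro v
    by_cases hv : v = P
    · subst hv
      obtain ⟨S, hPS, hS⟩ := ord_eq_neg_sum hP g
      rw [hS, dvd_neg]
      exact Finset.dvd_sum fun w hw => (hdvd w fun e => hPS (e ▸ hw)).mul_right _
    · exact hdvd v hv
  have hq0 : (q : ℤ) ≠ 0 := by exact_mod_cast hq.ne'
  -- The quotient of the divisor of `g` by `q ^ (k + 1)`; it has degree `0` because `ℤ` is
  -- torsion-free.
  set D : Divisor F := (divisor ℓ g).mapRange (· / (q ^ (k + 1) : ℤ)) (by simp) with hD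
  have hDv : ∀ v, (q ^ (k + 1) : ℤ) * D v = ord v g := fun v => Int.mul_ediv_cancel' (hdvd' v)
  have hDg : q ^ (k + 1) • D = divisor ℓ g := by
    ext v
    simpa using hDv v
  have hdeg : D ∈ (degree ℓ F).ker := by
    have h := degree_divisor (ℓ := ℓ) g
    rw [← hDg, map_nsmul, smul_eq_zero] at h
    exact h.resolve_left (pow_ne_zero _ hq.ne')
  have h1 := nsmul_eq_zero_of_torsionCard_eq (pow_dvd_pow q k.le_succ) htors
    (QuotientAddGroup.mk ⟨D, hdeg⟩) (by
      rw [← QuotientAddGroup.mk_nsmul, QuotientAddGroup.eq_zero_iff, AddSubgroup.mem_addSubgroupOf]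
      refine ⟨g, hg, fun v => ?_⟩
      simpa using hDv v)
  rw [← QuotientAddGroup.mk_nsmul, QuotientAddGroup.eq_zero_iff, AddSubgroup.mem_addSubgroupOf] at h1
  obtain ⟨z, hz0, hz⟩ := h1
  have hord : ∀ v, ord v g = q * ord v z := by
    intro v
    rw [← hz v, ← hDv v]
    simp only [AddSubgroup.coe_nsmul, Finsupp.smul_apply, nsmul_eq_mul, Nat.cast_pow]
    ring
  have hzq : z ^ q ≠ 0 := pow_ne_zero _ hz0
  refine ⟨g * (z ^ q)⁻¹, mem_constants_of_forall_ord_eq_zero fun v => ?_, z, fun v hv => ?_, ?_⟩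
  · rw [ord_mul v hg (inv_ne_zero hzq), ord_inv, ord_pow, hord]
    ring
  · rw [← val_le_one_iff, val_le_one_iff_ord_nonneg v hz0]
    have h2 := (val_le_one_iff_ord_nonneg v hg).mp (val_le_one_iff.mpr (hgP v hv))
    rw [hord] at h2
    exact nonneg_of_mul_nonneg_right h2 (by positivity)
  · field_simp

/-- The equation `u z ^ q - w y ^ q = c` with constant coefficients has only constant solutions. -/
theorem mem_constants_of_fermat {P : Prime F} (hP : primeDegree ℓ P = 1) {q : ℕ} (hq : 2 ≤ q)
    (hqF : (q : F) ≠ 0) {u w c z y : F} (hu : u ∈ constants ℓ F) (hw : w ∈ constants ℓ F)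
    (hc : c ∈ constants ℓ F) (hu0 : u ≠ 0) (hw0 : w ≠ 0) (hc0 : c ≠ 0) (hz : z ∈ integers P)
    (hy : y ∈ integers P) (h : u * z ^ q - w * y ^ q = c) : y ∈ constants ℓ F := by
  by_contra hyκ
  have hy0 : y ≠ 0 := fun h => hyκ (h ▸ zero_mem _)
  have hq0 : q ≠ 0 := by omega
  obtain ⟨v, hv⟩ := exists_one_lt_val hyκ
  obtain rfl : v = P := by
    by_contra hvP
    exact hv.not_ge (val_le_one_iff.mpr (hy v hvP))
  have hr : (z / y) ^ q - w / u = c / u * (y ^ q)⁻¹ := by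
    rw [← h, div_pow]
    field_simp
  have hsmall : val v ((z / y) ^ q - w / u) < 1 := by
    rw [hr, map_mul, val_constant v (div_mem hc hu) (div_ne_zero hc0 hu0), one_mul, map_inv₀,
      map_pow]
    exact inv_lt_one_of_one_lt₀ (one_lt_pow₀ hv hq0)
  have hwu : val v (w / u) = 1 := val_constant v (div_mem hw hu) (div_ne_zero hw0 hu0)
  have hzy : z / y ∈ v.ring := by
    rw [← val_le_one_iff, ← pow_le_one_iff hq0, ← map_pow]
    have := (val v).map_add_le hsmall.le hwu.le
    rwa [sub_add_cancel] at this
  obtain ⟨β, hβ, hβv⟩ := exists_constant_val_sub_lt_one hP hzy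
  -- Both sides are constants congruent modulo the maximal ideal at `P`, where a nonzero constant is
  -- a unit.
  have hβq : β ^ q = w / u := by
    by_contra hne
    have h1 : val v (β ^ q - w / u) = 1 :=
      val_constant v (sub_mem (pow_mem hβ q) (div_mem hw hu)) (sub_ne_zero.mpr hne)
    have h2 : val v ((z / y) ^ q - β ^ q) < 1 := by
      rw [← geom_sum₂_mul, map_mul]
      refine (mul_le_of_le_one_left' ?_).trans_lt hβv
      exact val_le_one_iff.mpr (sum_mem fun i _ =>
        mul_mem (pow_mem hzy _) (pow_mem (constants_mem ℓ v ⟨β, hβ⟩) _))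
    have h3 := (val v).map_sub_lt hsmall h2
    rw [sub_sub_sub_cancel_left, h1] at h3
    exact h3.false
  have hβ0 : β ≠ 0 := by
    rintro rfl
    rw [zero_pow hq0] at hβq
    exact div_ne_zero hw0 hu0 hβq.symm
  have hfac : z ^ q - (β * y) ^ q = c / u := by
    rw [mul_pow, hβq, ← h]
    field_simp
  have hd0 : z - β * y ≠ 0 := by
    intro h0
    rw [sub_eq_zero.mp h0, sub_self] at hfac
    exact div_ne_zero hc0 hu0 hfac.symm
  have hβy : β * y ∈ integers v := mul_mem (constants_mem_integers v hβ) hy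
  -- The factorization of `z ^ q - (β y) ^ q = c / u` exhibits the inverse of `z - β y` inside
  -- `𝒪_F`.
  have hinv : (z - β * y)⁻¹ =
      (∑ i ∈ Finset.range q, z ^ i * (β * y) ^ (q - 1 - i)) * (u / c) := by
    rw [← geom_sum₂_mul] at hfac
    refine inv_eq_of_mul_eq_one_right ?_
    rw [mul_comm, mul_right_comm, hfac]
    field_simp
  have hd : z - β * y ∈ constants ℓ F := by
    refine mem_constants_of_inv_mem_integers hP (sub_mem hz hβy) ?_
    rw [hinv]
    exact mul_mem (sum_mem fun i _ => mul_mem (pow_mem hz _) (pow_mem hβy _))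
      (constants_mem_integers v (div_mem hu hc))
  let d' : constants ℓ F := ⟨z - β * y, hd⟩
  let β' : constants ℓ F := ⟨β, hβ⟩
  let e' : constants ℓ F := ⟨c / u, div_mem hc hu⟩
  refine transcendental_of_notMem hyκ
    ⟨(C d' + C β' * X) ^ q - (C β' * X) ^ q - C e', fun hp => ?_, ?_⟩
  -- The derivative at `0` is the linear coefficient `q d ^ (q - 1) β`; as `q ≥ 2`, the term `(β X)
  -- ^ q` does not contribute.
  · have h1 := congrArg (fun p => eval 0 (derivative p)) hp
    simp only [derivative_sub, derivative_pow, derivative_add, derivative_mul, derivative_C,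
      derivative_X, eval_sub, eval_mul, eval_pow, eval_add, eval_C, eval_X, map_natCast,
      eval_natCast, derivative_zero, eval_zero, mul_zero, zero_mul, add_zero, zero_add, mul_one,
      zero_pow (show q - 1 ≠ 0 by omega), sub_zero] at h1
    have h2 : (q : F) * (z - β * y) ^ (q - 1) * β = 0 := congrArg Subtype.val h1
    exact mul_ne_zero (mul_ne_zero hqF (pow_ne_zero _ hd0)) hβ0 h2
  · have h1 : aeval y ((C d' + C β' * X) ^ q - (C β' * X) ^ q - C e') =
        ((z - β * y) + β * y) ^ q - (β * y) ^ q - c / u := by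
      simp only [map_sub, map_pow, map_add, map_mul, aeval_C, aeval_X]
      rfl
    rw [h1, sub_add_cancel, hfac, sub_self]

end Equation

end GlobalFF

end

/-! ### The main theorem -/

theorem theorem2p3
    -- a global function field `F` of characteristic `ℓ`
    (ℓ : ℕ) [Fact ℓ.Prime] (F : Type*) [Field F] [Algebra (ZMod ℓ) F]
    [Algebra (RatFunc (ZMod ℓ)) F] [IsScalarTower (ZMod ℓ) (RatFunc (ZMod ℓ)) F]
    [FunctionField (ZMod ℓ) F]
    -- a prime `P` of degree one
    (P : GlobalFF.Prime F) (hP : GlobalFF.primeDegree ℓ P = 1)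
    -- the prime `q ≠ ℓ` and the least `k > 0` with `h_F[q ^ k] = h_F[q ^ (k - 1)]`
    (q : ℕ) (hq : q.Prime) (hqℓ : q ≠ ℓ) (k : ℕ)
    (hk : IsLeast {m : ℕ | 0 < m ∧
      GlobalFF.torsionCard ℓ F (q ^ m) = GlobalFF.torsionCard ℓ F (q ^ (m - 1))} k)
    -- the polynomial `f` over the field of constants
    (f : Polynomial (GlobalFF.constants ℓ F))
    (t : ℕ) (ht : 2 ≤ t) (a₀ : GlobalFF.constants ℓ F) (ha₀ : a₀ ≠ 0)
    (a : Fin t → GlobalFF.constants ℓ F) (ha : Function.Injective a)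
    (n : Fin t → ℕ) (hn : ∀ i, 0 < n i)
    (hf : f = Polynomial.C a₀ * ∏ i, (Polynomial.X - Polynomial.C (a i)) ^ n i)
    (hnq : ∃ i j, i ≠ j ∧ ¬ q ∣ n i ∧ ¬ q ∣ n j)
    (X Y : F) (hX : X ∈ GlobalFF.integers P) (hY : Y ∈ GlobalFF.integers P)
    (hXY : Y ^ q ^ k = Polynomial.aeval X f) :
    X ∈ GlobalFF.constants ℓ F ∧ Y ∈ GlobalFF.constants ℓ F := by
  classical
  have := GlobalFF.isGlobal_of_functionField ℓ F
  obtain ⟨⟨hk0, htors⟩, -⟩ := hk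
  have hqk : 0 < q ^ k := pow_pos hq.pos k
  -- If `X` is constant, a positive power of `Y` is constant, so `Y` is algebraic over `κ`.
  suffices hXκ : X ∈ GlobalFF.constants ℓ F by
    refine ⟨hXκ, GlobalFF.mem_constants_of_isAlgebraic (IsAlgebraic.of_pow hqk ?_)⟩
    rw [hXY]
    have : Polynomial.aeval X f = algebraMap (GlobalFF.constants ℓ F) F
        (Polynomial.aeval (⟨X, hXκ⟩ : GlobalFF.constants ℓ F) f) :=
      Polynomial.aeval_algebraMap_apply F (⟨X, hXκ⟩ : GlobalFF.constants ℓ F) f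
    rw [this]
    exact isAlgebraic_algebraMap _
  by_contra hXκ
  have hne : ∀ i, X - a i ≠ 0 := fun i h => hXκ (sub_eq_zero.mp h ▸ (a i).2)
  have hprod : Y ^ q ^ k = (a₀ : F) * ∏ i, (X - a i) ^ n i := by
    rw [hXY, hf]
    simp only [map_mul, map_prod, map_pow, map_sub, Polynomial.aeval_C, Polynomial.aeval_X]
    rfl
  have ha₀' : (a₀ : F) ≠ 0 := fun h => ha₀ (Subtype.ext h)
  have hint : ∀ i, X - a i ∈ GlobalFF.integers P := fun i =>
    sub_mem hX (GlobalFF.constants_mem_integers P (a i).2)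
  have hord : ∀ v, (q ^ k : ℤ) * GlobalFF.ord v Y = ∑ i, n i * GlobalFF.ord v (X - a i) := by
    intro v
    have h1 := congrArg (GlobalFF.ord v) hprod
    have h2 : ∀ s : Finset (Fin t), GlobalFF.ord v (∏ i ∈ s, (X - a i) ^ n i) =
        ∑ i ∈ s, n i * GlobalFF.ord v (X - a i) := by
      intro s
      induction s using Finset.induction_on with
      | empty => simp [GlobalFF.ord_one]
      | insert i s hi ih =>
        rw [Finset.prod_insert hi, Finset.sum_insert hi, GlobalFF.ord_mul v
          (pow_ne_zero _ (hne i)) (Finset.prod_ne_zero_iff.mpr fun j _ => pow_ne_zero _ (hne j)),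
          ih, GlobalFF.ord_pow]
    rw [GlobalFF.ord_pow, GlobalFF.ord_mul v ha₀' (Finset.prod_ne_zero_iff.mpr fun i _ =>
      pow_ne_zero _ (hne i)), GlobalFF.ord_constant v a₀.2, zero_add, h2] at h1
    exact_mod_cast h1
  have hroot : ∀ i, ¬ q ∣ n i →
      ∃ c ∈ GlobalFF.constants ℓ F, ∃ z ∈ GlobalFF.integers P, X - a i = c * z ^ q := by
    intro i hi
    refine GlobalFF.exists_eq_constant_mul_pow hP hq.pos hk0 htors (hne i) (fun v hv => ?_)
      (hint i)
    have hnonneg : 0 ≤ GlobalFF.ord v (X - a i) :=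
      (GlobalFF.val_le_one_iff_ord_nonneg v (hne i)).mp
        (GlobalFF.val_le_one_iff.mpr (hint i v hv))
    rcases hnonneg.eq_or_lt with h0 | hpos
    · rw [← h0]
      exact dvd_zero _
    have hother : ∀ j, j ≠ i → GlobalFF.ord v (X - a j) = 0 := by
      intro j hj
      have hij : (a i : F) - a j ≠ 0 := fun h => hj (ha (Subtype.ext (sub_eq_zero.mp h))).symm
      have h1 := GlobalFF.val_constant v (sub_mem (a i).2 (a j).2) hij
      have h2 : X - a j = (X - a i) + (a i - a j) := by ring
      have h3 : GlobalFF.val v (X - a j) = 1 := by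
        rw [h2, (GlobalFF.val v).map_add_eq_of_lt_right, h1]
        rw [h1]
        exact (GlobalFF.val_lt_one_iff_ord_pos v (hne i)).mpr hpos
      rw [GlobalFF.ord_eq, h3, WithZero.log_one, neg_zero]
    have h1 := hord v
    -- At a zero of `X - a i` only the `i`-th term survives: `q ^ k * ord v Y = n i * ord v (X - a
    -- i)`, with `n i` prime to `q`.
    rw [Finset.sum_eq_single i (fun j _ hj => by rw [hother j hj, mul_zero]) (by simp)] at h1
    have hcop : IsCoprime (q ^ k : ℤ) (n i) := by
      refine IsCoprime.pow_left ?_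
      exact_mod_cast Nat.isCoprime_iff_coprime.mpr ((Nat.Prime.coprime_iff_not_dvd hq).mpr hi)
    exact hcop.dvd_of_dvd_mul_left ⟨_, h1.symm⟩
  obtain ⟨i, j, hij, hi, hj⟩ := hnq
  obtain ⟨u, hu, z, hz, huz⟩ := hroot i hi
  obtain ⟨w, hw, y, hy, hwy⟩ := hroot j hj
  have hu0 : u ≠ 0 := by
    rintro rfl
    exact hne i (by rw [huz, zero_mul])
  have hw0 : w ≠ 0 := by
    rintro rfl
    exact hne j (by rw [hwy, zero_mul])
  have hqF : (q : F) ≠ 0 := by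
    have : CharP F ℓ := charP_of_injective_algebraMap (algebraMap (ZMod ℓ) F).injective ℓ
    rw [Ne, CharP.cast_eq_zero_iff F ℓ]
    exact fun h => hqℓ ((Nat.prime_dvd_prime_iff_eq Fact.out hq).mp h).symm
  have hyκ : y ∈ GlobalFF.constants ℓ F := by
    refine GlobalFF.mem_constants_of_fermat hP hq.two_le hqF hu hw
      (c := a j - a i) (sub_mem (a j).2 (a i).2) hu0 hw0
      (fun h => hij (ha (Subtype.ext (sub_eq_zero.mp h))).symm) hz hy ?_
    rw [← huz, ← hwy]
    ring
  refine hXκ ?_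
  have hX' : X = w * y ^ q + a j := by rw [← hwy]; ring
  rw [hX']
  exact add_mem (mul_mem hw (pow_mem hyκ q)) (a j).2
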